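/- Let $L \ge 4$ be even and let $G$ be the $L \times L$ toric grid: its vertex set is $V = \{1,\dots,L\}^2$, and two vertices are adjacent if they agree in one coordinate and differ by $1$ modulo $L$ in the other. Let $\Omega$ be the set of independent sets of $G$. Fix $\lambda, \mu > 0$, and for $\nu > 0$ and $p \in (0,1]$ let $\{(X(t), Q(t))\}_{t \ge 0}$ be the continuous-time Markov process on $\Omega \times \mathbb{N}^V$ ($X(t)$ is the set of active nodes, $Q_i(t)$ is the number of packets waiting at node $i$) with the following transitions from a state $(X,Q)$, for each node $i \in V$: to $(X, Q + e_i)$ at rate $\lambda$; if $i \notin X$ and no neighbor of $i$ is in $X$, to $(X \cup \{i\}, Q - e_i \mathbf{1}_{\{Q_i > 0\}})$ at rate $\nu$; if $i \in X$, to $(X \setminus \{i\}, Q)$ at rate $p\mu$ and to $(X, Q - e_i \mathbf{1}_{\{Q_i > 0\}})$ at rate $(1-p)\mu$. Put $\sigma = \nu/(p\mu)$. If the normalized load $\rho = \lambda/(\mu/2) = 2\lambda/\mu$ satisfies $\rho < 1$, then there is a $\sigma_0$, depending only on $L$, $\lambda$ and $\mu$, such that for all $\nu > 0$ and $p \in (0,1]$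 with $\sigma > \sigma_0$ and for every node $i$ the queue-length process $\{Q_i(t)\}_{t \ge 0}$ is positive recurrent. That is, from every initial state of the network, the expected time until $Q_i$ returns to any given value (more precisely, until it takes that value after having been away from it) is finite, and the same holds for the Markov process $\{(X(t), Q_i(t))\}_{t \ge 0}$ and each of its states. -/

import Mathlib

open MeasureTheory ProbabilityTheory
open scoped ENNReal NNReal

noncomputable section

/-! ### Continuous-time Markov chains on a countable state space

A chain is given by its transition rates `r : E → E → ℝ≥0∞`; the diagonal entries of `r` play no
role. The chain is built from its jump chain and its exponential holding times. -/

namespace CTMC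

variable {E : Type*}

open Classical in
/-- The transition rates with the diagonal put to zero (a transition from a state to itself is not a
jump of the chain). -/
def offDiag (r : E → E → ℝ≥0∞) (x y : E) : ℝ≥0∞ := if y = x then 0 else r x y

/-- Total rate at which the chain leaves the state `x`. -/
def exitRate (r : E → E → ℝ≥0∞) (x : E) : ℝ≥0∞ := ∑' y, offDiag r x y

open Classical in
/-- Law of the state after a jump from `x`: the state `y ≠ x` has probability
`r x y / exitRate r x`. (A state whose exit rate is `0` is absorbing.) -/
def jumpLaw (r : E → E → ℝ≥0∞) (x : E) : PMF E :=
  if h : exitRate r x ≠ 0 ∧ exitRate r x ≠ ∞ then PMF.normalize (offDiag r x) h.1 h.2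
  else PMF.pure x

open Classical in
/-- Law of the holding time in a state with exit rate `q`: exponential with parameter `q`
(equal to `∞` if `q = 0`, and to `0` if `q = ∞`). -/
def holdLaw (q : ℝ≥0∞) : Measure ℝ≥0∞ :=
  if q = 0 then Measure.dirac ∞
  else if q = ∞ then Measure.dirac 0
  else (expMeasure q.toReal).map ENNReal.ofReal

instance isProbabilityMeasure_holdLaw (q : ℝ≥0∞) : IsProbabilityMeasure (holdLaw q) := by
  unfold holdLaw
  split_ifs with h0 h1
  · infer_instance
  · infer_instance
  · have := isProbabilityMeasure_expMeasure (ENNReal.toReal_pos h0 h1)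
    exact Measure.isProbabilityMeasure_map ENNReal.measurable_ofReal.aemeasurable

variable [MeasurableSpace E]

/-- From the state `x`: the holding time in `x` and, independently of it, the next state. -/
def stepLaw (r : E → E → ℝ≥0∞) (x : E) : Measure (ℝ≥0∞ × E) :=
  (holdLaw (exitRate r x)).prod (jumpLaw r x).toMeasure

instance isProbabilityMeasure_stepLaw (r : E → E → ℝ≥0∞) (x : E) :
    IsProbabilityMeasure (stepLaw r x) := by
  unfold stepLaw; infer_instance

variable [DiscreteMeasurableSpace E] [Countable E]

/-- `stepLaw` as a kernel which reads the last state visited so far. -/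
def stepKernel (r : E → E → ℝ≥0∞) (n : ℕ) :
    Kernel ((i : Finset.Iic n) → (fun _ : ℕ => ℝ≥0∞ × E) i) (ℝ≥0∞ × E) :=
  (Kernel.ofFunOfCountable (stepLaw r)).comap
    (fun h => (h ⟨n, Finset.mem_Iic.2 le_rfl⟩).2) (by fun_prop)

instance isMarkovKernel_stepKernel (r : E → E → ℝ≥0∞) (n : ℕ) :
    IsMarkovKernel (stepKernel r n) :=
  ⟨fun h => by
    rw [stepKernel, Kernel.comap_apply]
    exact isProbabilityMeasure_stepLaw r _⟩

/-- Law of the chain started in `x`, as a law of sequences `ω`: `(ω n).2` is the `n`-th state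
visited, `(ω (n + 1)).1` is the holding time in it, and `(ω 0).1 = 0`. -/
def law (r : E → E → ℝ≥0∞) (x : E) : Measure (ℕ → ℝ≥0∞ × E) :=
  Kernel.trajMeasure (X := fun _ => ℝ≥0∞ × E) (Measure.dirac (0, x)) (stepKernel r)

/-- Expected value of `T` for the chain started in `x`. -/
def expect (r : E → E → ℝ≥0∞) (x : E) (T : (ℕ → ℝ≥0∞ × E) → ℝ≥0∞) : ℝ≥0∞ :=
  ∫⁻ ω, T ω ∂(law r x)

end CTMC

namespace CTMC

variable {E F : Type*}

/-- Time at which the `n`-th state visited is entered. -/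
def jumpTime (ω : ℕ → ℝ≥0∞ × E) (n : ℕ) : ℝ≥0∞ := ∑ k ∈ Finset.range (n + 1), (ω k).1

open Classical in
/-- The state at time `t`: the `n`-th state visited if `t` lies between its entrance time and the
next jump time, and `none` if infinitely many jumps happen before time `t`. -/
def stateAt (ω : ℕ → ℝ≥0∞ × E) (t : ℝ≥0) : Option E :=
  if h : ∃ n, jumpTime ω n ≤ t ∧ (t : ℝ≥0∞) < jumpTime ω (n + 1) then
    some (ω (Nat.find h)).2
  else none

/-- First time that the path `f` is at `v` after having been away from `v`. If `f` starts at `v`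
this is the return time to `v`, otherwise it is the hitting time of `v`. -/
def returnTime (f : ℝ≥0 → Option F) (v : F) : ℝ≥0∞ :=
  ⨅ (t : ℝ≥0) (_ : (∃ s < t, f s ≠ some v) ∧ f t = some v), (t : ℝ≥0∞)

/-- The process `g (X t)`, a function of the state `X t` of the chain with rates `r`, is positive
recurrent: from every initial state of the chain, the expected return time to every value of `g` is
finite. -/
def PositiveRecurrent [MeasurableSpace E] [DiscreteMeasurableSpace E] [Countable E]
    (r : E → E → ℝ≥0∞) (g : E → F) : Prop :=
  ∀ x y : E, expect r x (fun ω => returnTime (fun t => (stateAt ω t).map g) (g y)) < ∞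

end CTMC

/-! ### The random-access network -/

/-- State `(X, Q)` of the network with conflict graph `G`: `X` is the (independent) set of active
nodes and `Q i` is the number of packets waiting at node `i`, not counting a packet that is being
transmitted. -/
@[ext]
structure NetState {V : Type*} (G : SimpleGraph V) where
  active : Finset V
  indep : G.IsIndepSet (active : Set V)
  queue : V → ℕ

namespace NetState

variable {V : Type*} {G : SimpleGraph V}

instance : MeasurableSpace (NetState G) := ⊤

instance : DiscreteMeasurableSpace (NetState G) := ⟨fun _ => trivial⟩

instance [Finite V] : Countable (NetState G) := by
  have hinj : Function.Injective
      (fun s : NetState G => ((s.active, s.queue) : Finset V × (V → ℕ))) := by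
    intro s t h
    simp only [Prod.mk.injEq] at h
    exact NetState.ext h.1 h.2
  exact hinj.countable

/-- Node `i` is unblocked: neither `i` nor any of its neighbors is active. -/
def Unblocked (s : NetState G) (i : V) : Prop := i ∉ s.active ∧ ∀ j ∈ s.active, ¬ G.Adj i j

/-- Queue lengths after an arrival at node `i`. -/
def arrive [DecidableEq V] (Q : V → ℕ) (i : V) : V → ℕ := Function.update Q i (Q i + 1)

/-- Queue lengths after node `i` starts a transmission: `Q i` decreases by one if it is positive, and
nothing changes (a dummy packet is transmitted) if it is zero. -/
def depart [DecidableEq V] (Q : V → ℕ) (i : V) : V → ℕ :=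
  Function.update Q i (if 0 < Q i then Q i - 1 else 0)

end NetState

open Classical in
/-- Transition rates of `(X, Q)` on the conflict graph `G` with arrival rate `lam`, transmission
rate `mu`, activation (back-off) rate `nu` and back-off probability `p` at every node. The four
terms are: arrivals, activations, completions followed by a back-off period, and completions followed
immediately by another transmission. -/
def networkRate {V : Type*} [Fintype V] [DecidableEq V] (G : SimpleGraph V) (lam mu nu p : ℝ)
    (s s' : NetState G) : ℝ≥0∞ :=
  ∑ i : V,
    ((if s'.active = s.active ∧ s'.queue = NetState.arrive s.queue i
        then ENNReal.ofReal lam else 0)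
    + (if s.Unblocked i ∧ s'.active = insert i s.active ∧ s'.queue = NetState.depart s.queue i
        then ENNReal.ofReal nu else 0)
    + (if i ∈ s.active ∧ s'.active = s.active.erase i ∧ s'.queue = s.queue
        then ENNReal.ofReal (p * mu) else 0)
    + (if i ∈ s.active ∧ s'.active = s.active ∧ s'.queue = NetState.depart s.queue i
        then ENNReal.ofReal ((1 - p) * mu) else 0))

/-- The `L × L` toric grid: two vertices are adjacent if they differ by `1` modulo `L` in exactly one
coordinate and agree in the other one. -/
def toricGrid (L : ℕ) : SimpleGraph (Fin L × Fin L) :=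
  (SimpleGraph.cycleGraph L).boxProd (SimpleGraph.cycleGraph L)

end

/-! Activations and back-offs ignore the queues, because an empty node transmits a dummy packet. So
X(t) is by itself the hard-core chain on independent sets, with stationary weights σ^|X|, and (X,
Q_i) evolves independently of the other queues. For large σ, sets smaller than a given independent
set carry little weight. On an even torus one parity class contains at least half of the vertices.
By vertex transitivity every node is then active with stationary probability at least (1 -
2^(L²)/σ)/2 (`le_occupancy_toricGrid`), which exceeds λ/μ once σ is large, so Q_i has negative mean
drift.

The drift is negative only on average over X. Solving the Poisson equation for 1_{i ∈ X} minus its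
mean (`HardCore.exists_gen_eq`) gives a corrector f such that Q_i + 1_{i ∈ X} + μ f(X) has drift at
most a negative constant whenever Q_i > 0. The finitely many values with Q_i = 0 are handled by
adding a multiple of the bounded function 1 - θ^d, where d bounds the number of transitions to the
target (`NetState.exists_bounded_generator_le`). The sum is the Lyapunov function of
`NetState.exists_lyapunov`.

Foster's criterion (`NetState.positiveRecurrent_of_generator_le`) rests on
`CTMC.expect_returnTime_lt_top`: a one-step inequality is summed along the jump chain. Each jump is
charged its holding time plus one, so a path that never returns has infinite cost, and almost sure
return needs no separate proof. -/

noncomputable section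

namespace CTMC

/-! ### Expectations under the law of a chain -/

/-- Multiplying the exponential density by q t gives the Gamma density of shape 2, whose total mass
is 1. -/
theorem lintegral_ofReal_expMeasure {q : ℝ} (hq : 0 < q) :
    ∫⁻ t, ENNReal.ofReal t ∂(expMeasure q) = (ENNReal.ofReal q)⁻¹ := by
  have hpdf : ∀ a, Measurable (gammaPDF a q) := fun a =>
    (measurable_gammaPDFReal a q).ennreal_ofReal
  have hkey : ∀ t : ℝ, ENNReal.ofReal q * (gammaPDF 1 q t * ENNReal.ofReal t) = gammaPDF 2 q t := by
    intro t
    rcases lt_or_ge t 0 with ht | ht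
    · rw [gammaPDF_of_neg ht, gammaPDF_of_neg ht]; simp
    · rw [gammaPDF_of_nonneg ht, gammaPDF_of_nonneg ht, ← ENNReal.ofReal_mul (by positivity),
        ← ENNReal.ofReal_mul hq.le]
      congr 1
      norm_num [Real.Gamma_two]
      ring
  have h1 : ENNReal.ofReal q * ∫⁻ t, ENNReal.ofReal t ∂(expMeasure q) = 1 := by
    rw [expMeasure, gammaMeasure, lintegral_withDensity_eq_lintegral_mul _ (hpdf 1)
      ENNReal.measurable_ofReal, ← lintegral_const_mul _ (by fun_prop)]
    simp only [Pi.mul_apply, hkey]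
    exact lintegral_gammaPDF_eq_one two_pos hq
  exact ENNReal.eq_inv_of_mul_eq_one_left (by rw [mul_comm]; exact h1)

theorem lintegral_holdLaw {q : ℝ≥0∞} (h0 : q ≠ 0) (h1 : q ≠ ∞) :
    ∫⁻ t, t ∂(holdLaw q) = q⁻¹ := by
  rw [holdLaw, if_neg h0, if_neg h1, lintegral_map (f := fun t => t) measurable_id ENNReal.measurable_ofReal,
    lintegral_ofReal_expMeasure (ENNReal.toReal_pos h0 h1), ENNReal.ofReal_toReal h1]

/-- Positive holding times make every visited state visible in continuous time, so that a return of
the jump chain is a return of the process. -/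
theorem holdLaw_ae_pos {q : ℝ≥0∞} (h1 : q ≠ ∞) : ∀ᵐ t ∂(holdLaw q), 0 < t := by
  by_cases h0 : q = 0
  · rw [holdLaw, if_pos h0, ae_dirac_eq]; simp
  rw [holdLaw, if_neg h0, if_neg h1,
    ae_map_iff ENNReal.measurable_ofReal.aemeasurable measurableSet_Ioi]
  simp only [ENNReal.ofReal_pos]
  have hpdf : Measurable (gammaPDF 1 q.toReal) := (measurable_gammaPDFReal 1 _).ennreal_ofReal
  rw [expMeasure, gammaMeasure, ae_withDensity_iff hpdf]
  filter_upwards [Measure.ae_ne volume (0 : ℝ)] with t ht hp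
  exact lt_of_le_of_ne (not_lt.1 fun h => hp (gammaPDF_of_neg h)) ht.symm

theorem jumpLaw_apply {E : Type*} {r : E → E → ℝ≥0∞} {x : E} (h0 : exitRate r x ≠ 0) (h1 : exitRate r x ≠ ∞)
    (y : E) : jumpLaw r x y = offDiag r x y * (exitRate r x)⁻¹ := by
  rw [jumpLaw, dif_pos ⟨h0, h1⟩]
  exact PMF.normalize_apply h0 h1 y

variable {E : Type*} [MeasurableSpace E] [DiscreteMeasurableSpace E] [Countable E]

theorem lintegral_jumpLaw {r : E → E → ℝ≥0∞} {x : E} (h0 : exitRate r x ≠ 0)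
    (h1 : exitRate r x ≠ ∞) (f : E → ℝ≥0∞) :
    ∫⁻ y, f y ∂(jumpLaw r x).toMeasure = (∑' y, offDiag r x y * f y) * (exitRate r x)⁻¹ := by
  rw [lintegral_countable', ← ENNReal.tsum_mul_right]
  refine tsum_congr fun y => ?_
  rw [PMF.toMeasure_apply_singleton _ _ (measurableSet_singleton y), jumpLaw_apply h0 h1]
  ring

/-- If the generator of the chain with rates `r`, applied to `f`, is at most `-1` at `x`, then one
step of the chain decreases `f` by at least the mean holding time. -/
theorem lintegral_stepLaw_le {r : E → E → ℝ≥0∞} {x : E} {f : E → ℝ≥0∞} {R : ℝ≥0∞} (hR : R ≠ ∞)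
    (hxR : exitRate r x ≤ R)
    (h : ∑' y, offDiag r x y * f y + 1 ≤ exitRate r x * f x) :
    ∫⁻ z, ((z.1 + 1) + (1 + R) * f z.2) ∂(stepLaw r x) ≤ (1 + R) * f x := by
  have h1 : exitRate r x ≠ ∞ := ne_top_of_le_ne_top hR hxR
  have h0 : exitRate r x ≠ 0 := by
    intro h0; rw [h0, zero_mul] at h; simp at h
  have hm : Measurable f := measurable_of_countable f
  rw [stepLaw, lintegral_add_left (by fun_prop), lintegral_const_mul _ (by fun_prop),
    lintegral_add_left (by fun_prop)]
  have e1 : ∫⁻ z : ℝ≥0∞ × E, z.1 ∂(holdLaw (exitRate r x)).prod (jumpLaw r x).toMeasure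
      = (exitRate r x)⁻¹ := by
    rw [lintegral_prod _ (by fun_prop)]
    simp [lintegral_holdLaw h0 h1]
  have e2 : ∫⁻ z : ℝ≥0∞ × E, f z.2 ∂(holdLaw (exitRate r x)).prod (jumpLaw r x).toMeasure
      = (∑' y, offDiag r x y * f y) * (exitRate r x)⁻¹ := by
    rw [lintegral_prod _ (by fun_prop)]
    simp [lintegral_jumpLaw h0 h1]
  rw [e1, e2]
  set q := exitRate r x
  set S := ∑' y, offDiag r x y * f y
  have hq : q * q⁻¹ = 1 := ENNReal.mul_inv_cancel h0 h1
  simp only [lintegral_const, measure_univ, mul_one]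
  -- The unit charge per jump is paid in time: since q ≤ R, 1 = q q⁻¹ ≤ R q⁻¹. This is where the
  -- factor 1 + R comes from.
  calc q⁻¹ + 1 + (1 + R) * (S * q⁻¹)
      ≤ q⁻¹ + R * q⁻¹ + (1 + R) * (S * q⁻¹) := by
        gcongr
        rw [← hq]; gcongr
    _ = (1 + R) * ((S + 1) * q⁻¹) := by ring
    _ ≤ (1 + R) * ((q * f x) * q⁻¹) := by gcongr
    _ = (1 + R) * (f x * (q * q⁻¹)) := by ring
    _ = (1 + R) * f x := by rw [hq, mul_one]

/-- Markov property: one-step integration against the law of the chain. -/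
theorem lintegral_law_succ (r : E → E → ℝ≥0∞) (x : E) (n : ℕ)
    (φ : (ℕ → ℝ≥0∞ × E) → ℝ≥0∞ × E → ℝ≥0∞)
    (hφ : Measurable fun p : (ℕ → ℝ≥0∞ × E) × (ℝ≥0∞ × E) => φ p.1 p.2)
    (hφn : ∀ ω ω' z, (∀ k ≤ n, ω k = ω' k) → φ ω z = φ ω' z) :
    ∫⁻ ω, φ ω (ω (n + 1)) ∂(law r x) =
      ∫⁻ ω, ∫⁻ z, φ ω z ∂(stepLaw r (ω n).2) ∂(law r x) := by
  -- A history up to `n` is prolonged by repeating its last entry; `φ` does not see the difference.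
  let ext : ((i : Finset.Iic n) → ℝ≥0∞ × E) → ℕ → ℝ≥0∞ × E :=
    fun h k => h ⟨min k n, Finset.mem_Iic.2 (min_le_right _ _)⟩
  have hext : Measurable ext := by
    refine measurable_pi_lambda _ fun k => ?_
    exact measurable_pi_apply _
  have hr : ∀ ω z, φ (ext (Preorder.frestrictLe (π := fun _ => ℝ≥0∞ × E) n ω)) z = φ ω z := by
    intro ω z
    refine hφn _ _ _ fun k hk => ?_
    simp [ext, hk]
  let ψ : ((i : Finset.Iic n) → ℝ≥0∞ × E) × (ℝ≥0∞ × E) → ℝ≥0∞ := fun p => φ (ext p.1) p.2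
  have hψ : Measurable ψ := hφ.comp ((hext.comp measurable_fst).prodMk measurable_snd)
  have hfr : Measurable (Preorder.frestrictLe (π := fun _ => ℝ≥0∞ × E) n) := by fun_prop
  have key := Kernel.map_frestrictLe_trajMeasure_compProd_eq_map_trajMeasure
    (X := fun _ => ℝ≥0∞ × E) (μ₀ := Measure.dirac (0, x)) (κ := stepKernel r) (a := n)
  have h1 := congrArg (fun m => ∫⁻ p, ψ p ∂m) key
  rw [Measure.lintegral_compProd hψ, lintegral_map hψ.lintegral_kernel_prod_right' hfr,
    lintegral_map hψ (by fun_prop)] at h1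
  simp only [ψ, hr] at h1
  rw [law, ← h1]
  rfl

theorem ae_law_succ (r : E → E → ℝ≥0∞) (x : E) (n : ℕ) {p : ℝ≥0∞ × E → Prop}
    (hp : MeasurableSet {z | p z}) (h : ∀ y, ∀ᵐ z ∂(stepLaw r y), p z) :
    ∀ᵐ ω ∂(law r x), p (ω (n + 1)) := by
  have hpc : MeasurableSet {z | ¬ p z} := hp.compl
  have key := lintegral_law_succ r x n (fun _ z => Set.indicator {z | ¬ p z} 1 z)
    ((measurable_one.indicator hpc).comp measurable_snd) (fun _ _ _ _ => rfl)
  have hz : ∀ y, ∫⁻ z, Set.indicator {z | ¬ p z} (1 : ℝ≥0∞ × E → ℝ≥0∞) z ∂(stepLaw r y) = 0 := by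
    intro y
    rw [lintegral_indicator_one hpc]
    exact h y
  simp only [hz, lintegral_zero] at key
  rw [lintegral_eq_zero_iff (f := fun ω : ℕ → ℝ≥0∞ × E =>
    Set.indicator {z | ¬ p z} (1 : ℝ≥0∞ × E → ℝ≥0∞) (ω (n + 1)))
    ((measurable_one.indicator hpc).comp (measurable_pi_apply _))] at key
  filter_upwards [key] with ω hω
  by_contra hcon
  simp [hcon] at hω

theorem law_ae_zero (r : E → E → ℝ≥0∞) (x : E) : ∀ᵐ ω ∂(law r x), ω 0 = (0, x) := by
  have hfr : Measurable (Preorder.frestrictLe (π := fun _ => ℝ≥0∞ × E) 0) := by fun_prop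
  have h0 : (law r x).map (Preorder.frestrictLe (π := fun _ => ℝ≥0∞ × E) 0)
      = (Measure.dirac (0, x)).map (MeasurableEquiv.piUnique
        (fun _ : Finset.Iic 0 => ℝ≥0∞ × E)).symm := by
    rw [law, Kernel.trajMeasure, Measure.map_comp _ _ hfr, Kernel.traj_map_frestrictLe]
    simp [Kernel.partialTraj_self, Measure.id_comp]
  have h1 : (law r x).map (fun ω => ω 0) = Measure.dirac (0, x) := by
    have : (fun ω : ℕ → ℝ≥0∞ × E => ω 0) = (fun h : (i : Finset.Iic 0) → ℝ≥0∞ × E =>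
        h ⟨0, Finset.mem_Iic.2 le_rfl⟩) ∘ Preorder.frestrictLe (π := fun _ => ℝ≥0∞ × E) 0 := rfl
    rw [this, ← Measure.map_map (measurable_pi_apply _) hfr, h0, Measure.map_map
      (measurable_pi_apply _) (MeasurableEquiv.measurable _)]
    exact Measure.map_id
  have h2 : ∀ᵐ z ∂(law r x).map (fun ω => ω 0), z = (0, x) := by
    rw [h1]
    exact (ae_dirac_iff (measurableSet_singleton _)).2 rfl
  exact ae_of_ae_map (measurable_pi_apply 0).aemeasurable h2

end CTMC

namespace CTMC

/-! ### Return times and supersolutions -/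

section Paths

variable {E : Type*}

theorem jumpTime_succ (ω : ℕ → ℝ≥0∞ × E) (n : ℕ) :
    jumpTime ω (n + 1) = jumpTime ω n + (ω (n + 1)).1 := by
  simp [jumpTime, Finset.sum_range_succ]

theorem jumpTime_mono (ω : ℕ → ℝ≥0∞ × E) : Monotone (jumpTime ω) :=
  monotone_nat_of_le_succ fun n => by rw [jumpTime_succ]; exact le_self_add

theorem stateAt_jumpTime {ω : ℕ → ℝ≥0∞ × E} {n : ℕ} (hpos : 0 < (ω (n + 1)).1)
    (hfin : jumpTime ω n ≠ ∞) : stateAt ω (jumpTime ω n).toNNReal = some (ω n).2 := by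
  have ht : (((jumpTime ω n).toNNReal : ℝ≥0) : ℝ≥0∞) = jumpTime ω n := ENNReal.coe_toNNReal hfin
  have hlt : jumpTime ω n < jumpTime ω (n + 1) := by
    rw [jumpTime_succ]; exact ENNReal.lt_add_right hfin hpos.ne'
  have hex : ∃ m, jumpTime ω m ≤ (jumpTime ω n).toNNReal ∧
      (((jumpTime ω n).toNNReal : ℝ≥0) : ℝ≥0∞) < jumpTime ω (m + 1) := by
    rw [ht]; exact ⟨n, le_rfl, hlt⟩
  have hfind : Nat.find hex = n := by
    refine le_antisymm (Nat.find_min' hex (by rw [ht]; exact ⟨le_rfl, hlt⟩)) ?_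
    by_contra hcon
    have h2 := (Nat.find_spec hex).2
    exact absurd (ht.symm.trans_lt h2) (not_lt.2 (jumpTime_mono ω (by omega)))
  rw [stateAt, dif_pos hex, hfind]

/-- If the `(n + 1)`-st state of a path belongs to the fibre of `g` over `v` and the `n`-th does
not, then `g` has returned to `v` when the `(n + 1)`-st state is entered. -/
theorem returnTime_le_jumpTime {F : Type*} {ω : ℕ → ℝ≥0∞ × E} (hpos : ∀ n, 0 < (ω (n + 1)).1)
    {g : E → F} {v : F} {n : ℕ} (hn : g (ω n).2 ≠ v) (hn1 : g (ω (n + 1)).2 = v) (h0 : (ω 0).1 = 0) :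
    returnTime (fun t => (stateAt ω t).map g) v ≤ ∑ k ∈ Finset.range (n + 1), (ω (k + 1)).1 := by
  have hsum : jumpTime ω (n + 1) = ∑ k ∈ Finset.range (n + 1), (ω (k + 1)).1 := by
    rw [jumpTime, Finset.sum_range_succ', h0, add_zero]
  rw [← hsum]
  by_cases hfin : jumpTime ω (n + 1) = ∞
  · rw [hfin]; exact le_top
  have hfin' : jumpTime ω n ≠ ∞ := ne_top_of_le_ne_top hfin (jumpTime_mono ω n.le_succ)
  have hlt : jumpTime ω n < jumpTime ω (n + 1) := by
    rw [jumpTime_succ]; exact ENNReal.lt_add_right hfin' (hpos n).ne'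
  refine (iInf₂_le (jumpTime ω (n + 1)).toNNReal ⟨⟨(jumpTime ω n).toNNReal,
    (ENNReal.toNNReal_lt_toNNReal hfin' hfin).2 hlt, ?_⟩, ?_⟩).trans
    (ENNReal.coe_toNNReal hfin).le
  · simpa [stateAt_jumpTime (hpos n) hfin'] using hn
  · simpa [stateAt_jumpTime (hpos (n + 1)) hfin] using hn1

open Classical in
/-- Progress of a path towards a return to `B`: `0` as long as it has stayed in `B`, `1` once it has
left `B` and has not come back yet, `2` from the return on. -/
def nextPhase (B : Set E) (s : Fin 3) (y : E) : Fin 3 :=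
  if s = 2 then 2 else if y ∈ B then (if s = 0 then 0 else 2) else 1

/-- Progress of a path towards a return to `B` after `n` jumps. -/
def phase (B : Set E) (ω : ℕ → ℝ≥0∞ × E) : ℕ → Fin 3
  | 0 => nextPhase B 0 (ω 0).2
  | n + 1 => nextPhase B (phase B ω n) (ω (n + 1)).2

theorem phase_congr (B : Set E) {ω ω' : ℕ → ℝ≥0∞ × E} {n : ℕ} (h : ∀ k ≤ n, ω k = ω' k) :
    phase B ω n = phase B ω' n := by
  induction n with
  | zero => simp [phase, h 0 le_rfl]
  | succ n ih => rw [phase, phase, ih fun k hk => h k (by omega), h _ le_rfl]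

theorem notMem_of_phase_eq_one {B : Set E} {ω : ℕ → ℝ≥0∞ × E} {n : ℕ} (h : phase B ω n = 1) :
    (ω n).2 ∉ B := by
  cases n <;> (simp only [phase, nextPhase] at h; split_ifs at h <;> simp_all)

/-- Phase 2 is absorbing and can be entered only from phase 1, by a jump into `B`; `m` is the index
just before the first entrance. -/
theorem exists_crossing_of_phase_eq_two {B : Set E} {ω : ℕ → ℝ≥0∞ × E} {n : ℕ}
    (h : phase B ω n = 2) : ∃ m, (∀ k ≤ m, phase B ω k ≠ 2) ∧ (ω m).2 ∉ B ∧ (ω (m + 1)).2 ∈ B := by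
  induction n with
  | zero => simp only [phase, nextPhase] at h; split_ifs at h <;> simp_all
  | succ n ih =>
    by_cases hn : ∃ k ≤ n, phase B ω k = 2
    · by_cases h2 : phase B ω n = 2
      · exact ih h2
      · exfalso
        obtain ⟨k, hk, hk2⟩ := hn
        have : ∀ j, phase B ω (k + j) = 2 := by
          intro j
          induction j with
          | zero => exact hk2
          | succ j ihj => rw [← add_assoc, phase, nextPhase, if_pos ihj]
        exact h2 (by simpa [Nat.add_sub_cancel' hk] using this (n - k))
    · push Not at hn
      have h2 := hn n le_rfl
      rw [phase, nextPhase, if_neg h2] at h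
      split_ifs at h with hB h0
      · simp at h
      · have h1 : phase B ω n = 1 := by
          generalize phase B ω n = s at h0 h2
          fin_cases s <;> simp_all
        exact ⟨n, hn, notMem_of_phase_eq_one h1, hB⟩
      · simp at h

/-- Cost of a step that starts in phase `s` and has holding time `t`. -/
def stepCost (s : Fin 3) (t : ℝ≥0∞) : ℝ≥0∞ := if s = 2 then 0 else t + 1

/-- The holding times up to the first crossing bound the return time. Without a crossing every term
is at least 1 and the series diverges, which is the purpose of the `+ 1` in `stepCost`. -/
theorem returnTime_le_tsum_stepCost {F : Type*} {ω : ℕ → ℝ≥0∞ × E}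
    (hpos : ∀ n, 0 < (ω (n + 1)).1) (h0 : (ω 0).1 = 0) (g : E → F) (v : F) :
    returnTime (fun t => (stateAt ω t).map g) v ≤
      ∑' n, stepCost (phase {y | g y = v} ω n) (ω (n + 1)).1 := by
  by_cases h : ∃ n, phase {y | g y = v} ω n = 2
  · obtain ⟨n, hn⟩ := h
    obtain ⟨m, hm, hmB, hmB'⟩ := exists_crossing_of_phase_eq_two hn
    refine (returnTime_le_jumpTime hpos hmB hmB' h0).trans ?_
    refine le_trans (Finset.sum_le_sum fun k hk => ?_) (ENNReal.sum_le_tsum (Finset.range (m + 1)))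
    rw [stepCost, if_neg (hm k (by simpa [Nat.lt_succ_iff] using hk))]
    exact le_self_add
  · push Not at h
    have : (∞ : ℝ≥0∞) ≤ ∑' n, stepCost (phase {y | g y = v} ω n) (ω (n + 1)).1 := by
      rw [← ENNReal.tsum_const_eq_top_of_ne_zero (α := ℕ) one_ne_zero]
      refine ENNReal.tsum_le_tsum fun n => ?_
      rw [stepCost, if_neg (h n)]
      exact le_add_self
    exact le_top.trans this

end Paths

/-! ### Expected cost until the return -/

variable {E : Type*} [MeasurableSpace E] [DiscreteMeasurableSpace E] [Countable E]

theorem measurable_phase (B : Set E) (n : ℕ) :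
    Measurable fun ω : ℕ → ℝ≥0∞ × E => phase B ω n := by
  have hn : Measurable fun p : Fin 3 × E => nextPhase B p.1 p.2 := Measurable.of_discrete
  induction n with
  | zero =>
    exact hn.comp (measurable_const.prodMk (measurable_snd.comp (measurable_pi_apply 0)))
  | succ n ih => exact hn.comp (ih.prodMk (measurable_snd.comp (measurable_pi_apply (n + 1))))

theorem measurable_stepCost : Measurable fun p : Fin 3 × ℝ≥0∞ => stepCost p.1 p.2 := by
  refine measurable_from_prod_countable_right fun s => ?_
  by_cases hs : s = 2 <;> simp only [stepCost, hs, if_true, if_false] <;> fun_prop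

/-- By the Markov property, the cost paid so far plus `W` at the current phase and state is a
supermartingale, so every partial sum has mean at most the initial `W`. -/
theorem lintegral_tsum_stepCost_le {r : E → E → ℝ≥0∞} {B : Set E} {W : Fin 3 → E → ℝ≥0∞}
    (hW : ∀ s y, ∫⁻ z, (stepCost s z.1 + W (nextPhase B s z.2) z.2) ∂(stepLaw r y) ≤ W s y)
    (x : E) :
    ∫⁻ ω, ∑' n, stepCost (phase B ω n) (ω (n + 1)).1 ∂(law r x) ≤ W (nextPhase B 0 x) x := by
  have hmW : Measurable fun p : Fin 3 × E => W p.1 p.2 := Measurable.of_discrete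
  have hmc : ∀ n, Measurable fun ω : ℕ → ℝ≥0∞ × E => stepCost (phase B ω n) (ω (n + 1)).1 :=
    fun n => measurable_stepCost.comp ((measurable_phase B n).prodMk
      (measurable_fst.comp (measurable_pi_apply (n + 1))))
  have hmWn : ∀ n, Measurable fun ω : ℕ → ℝ≥0∞ × E => W (phase B ω n) (ω n).2 :=
    fun n => hmW.comp ((measurable_phase B n).prodMk (measurable_snd.comp (measurable_pi_apply n)))
  have hn : Measurable fun p : Fin 3 × E => nextPhase B p.1 p.2 := Measurable.of_discrete
  have hstep : ∀ n, ∫⁻ ω, (stepCost (phase B ω n) (ω (n + 1)).1 +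
      W (phase B ω (n + 1)) (ω (n + 1)).2) ∂(law r x) ≤ ∫⁻ ω, W (phase B ω n) (ω n).2 ∂(law r x) := by
    intro n
    have hph : Measurable fun p : (ℕ → ℝ≥0∞ × E) × (ℝ≥0∞ × E) => phase B p.1 n :=
      (measurable_phase B n).comp measurable_fst
    have key := lintegral_law_succ r x n (fun ω z => stepCost (phase B ω n) z.1 +
      W (nextPhase B (phase B ω n) z.2) z.2) (by
        have hz : Measurable fun p : (ℕ → ℝ≥0∞ × E) × (ℝ≥0∞ × E) => p.2.2 := by fun_prop
        exact (measurable_stepCost.comp (hph.prodMk (measurable_fst.comp measurable_snd))).add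
          (hmW.comp ((hn.comp (hph.prodMk hz)).prodMk hz)))
      (fun ω ω' z h => by rw [phase_congr B h])
    refine key.le.trans (lintegral_mono fun ω => hW _ _)
  have hind : ∀ n, ∑ k ∈ Finset.range n, ∫⁻ ω, stepCost (phase B ω k) (ω (k + 1)).1 ∂(law r x) +
      ∫⁻ ω, W (phase B ω n) (ω n).2 ∂(law r x) ≤ W (nextPhase B 0 x) x := by
    intro n
    induction n with
    | zero =>
      simp only [Finset.range_zero, Finset.sum_empty, zero_add]
      rw [lintegral_congr_ae (g := fun _ => W (nextPhase B 0 x) x)]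
      · have : IsProbabilityMeasure (law r x) := by unfold law; infer_instance
        simp
      · filter_upwards [law_ae_zero r x] with ω hω
        simp [phase, hω]
    | succ n ih =>
      rw [Finset.sum_range_succ, add_assoc]
      refine le_trans ?_ ih
      gcongr
      rw [← lintegral_add_left (hmc n)]
      exact hstep n
  rw [lintegral_tsum fun n => (hmc n).aemeasurable, ENNReal.tsum_eq_iSup_nat]
  exact iSup_le fun n => le_self_add.trans (hind n)

/-- Supersolutions bound return times. Let `U₁` be a function with generator at most `-1` off the
fibre of `g` over `v`, vanishing on it, and let `U₀` agree with `U₁` off the fibre and have generator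
at most `-1` on it. If the exit rates are bounded, then the expected return time of `g` to `v` is
finite from every state at which `U₀` is. -/
theorem expect_returnTime_lt_top {F : Type*} {r : E → E → ℝ≥0∞} {g : E → F} {v : F} {R : ℝ≥0∞}
    (hR : R ≠ ∞) (hrR : ∀ x, exitRate r x ≤ R) {U₀ U₁ : E → ℝ≥0∞}
    (h0 : ∀ x, g x = v → ∑' y, offDiag r x y * U₀ y + 1 ≤ exitRate r x * U₀ x)
    (h1 : ∀ x, g x ≠ v → ∑' y, offDiag r x y * U₁ y + 1 ≤ exitRate r x * U₁ x)
    (h1B : ∀ x, g x = v → U₁ x = 0) (h01 : ∀ x, g x ≠ v → U₀ x = U₁ x) {x : E}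
    (hx : U₀ x ≠ ∞) :
    expect r x (fun ω => returnTime (fun t => (stateAt ω t).map g) v) < ∞ := by
  classical
  set B : Set E := {y | g y = v} with hB
  -- Phase 0 off the fibre and phase 1 on it never occur along a path; the value `∞` makes the
  -- inequality trivial there.
  let W : Fin 3 → E → ℝ≥0∞ := fun s y =>
    if s = 2 then 0
    else if s = 0 then (if g y = v then (1 + R) * U₀ y else ∞)
    else (if g y = v then ∞ else (1 + R) * U₁ y)
  have hW0 : ∀ z, W (nextPhase B 0 z) z = (1 + R) * U₀ z := by
    intro z
    by_cases hz : g z = v <;> simp [W, nextPhase, hB, hz, h01]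
  have hW1 : ∀ z, W (nextPhase B 1 z) z = (1 + R) * U₁ z := by
    intro z
    by_cases hz : g z = v <;> simp [W, nextPhase, hB, hz, h1B]
  have hmain : ∀ s y, ∫⁻ z, (stepCost s z.1 + W (nextPhase B s z.2) z.2) ∂(stepLaw r y) ≤ W s y := by
    intro s y
    fin_cases s
    · by_cases hy : g y = v
      · have := lintegral_stepLaw_le hR (hrR y) (h0 y hy)
        simpa [stepCost, hW0, W, hy] using this
      · simp [W, hy]
    · by_cases hy : g y = v
      · simp [W, hy]
      · have := lintegral_stepLaw_le hR (hrR y) (h1 y hy)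
        simpa [stepCost, hW1, W, hy] using this
    · simp [stepCost, W, nextPhase]
  have hpos : ∀ᵐ ω ∂(law r x), ∀ n, 0 < (ω (n + 1)).1 := by
    rw [ae_all_iff]
    intro n
    refine ae_law_succ r x n (p := fun z => 0 < z.1) (measurableSet_lt measurable_const
      measurable_fst) fun y => ?_
    exact Measure.quasiMeasurePreserving_fst.ae
      (holdLaw_ae_pos (ne_top_of_le_ne_top hR (hrR y)))
  calc expect r x (fun ω => returnTime (fun t => (stateAt ω t).map g) v)
      ≤ ∫⁻ ω, ∑' n, stepCost (phase B ω n) (ω (n + 1)).1 ∂(law r x) := by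
        refine lintegral_mono_ae ?_
        filter_upwards [hpos, law_ae_zero r x] with ω hω hω0
        exact returnTime_le_tsum_stepCost hω (by rw [hω0]) g v
    _ ≤ W (nextPhase B 0 x) x := lintegral_tsum_stepCost_le hmain x
    _ = (1 + R) * U₀ x := hW0 x
    _ < ∞ := ENNReal.mul_lt_top (by simpa using hR.lt_top) hx.lt_top

end CTMC

/-! ### Generators with finitely many transitions -/

namespace CTMC

variable {E ι : Type*} [Fintype ι]

open Classical in
-- Several indices may lead to the same state, and those with `τ k = x` are self-loops, which must
-- get rate zero.
theorem tsum_offDiag_mul {r : E → E → ℝ≥0∞} {x : E} {τ : ι → E} {c : ι → ℝ}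
    (hr : ∀ y ≠ x, r x y = ∑ k, if y = τ k then ENNReal.ofReal (c k) else 0) (f : E → ℝ≥0∞) :
    ∑' y, offDiag r x y * f y =
      ∑ k, ENNReal.ofReal (if τ k = x then 0 else c k) * f (τ k) := by
  have h1 : ∀ y, offDiag r x y * f y =
      ∑ k, if y = τ k then ENNReal.ofReal (if τ k = x then 0 else c k) * f (τ k) else 0 := by
    intro y
    by_cases hy : y = x
    · rw [offDiag, if_pos hy, zero_mul, eq_comm]
      refine Finset.sum_eq_zero fun k _ => ?_
      by_cases hk : y = τ k
      · rw [if_pos hk, if_pos (hk.symm.trans hy)]; simp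
      · rw [if_neg hk]
    · rw [offDiag, if_neg hy, hr y hy, Finset.sum_mul]
      refine Finset.sum_congr rfl fun k _ => ?_
      by_cases hk : y = τ k
      · rw [if_pos hk, if_pos hk, if_neg (hk ▸ hy), hk]
      · rw [if_neg hk, if_neg hk, zero_mul]
  simp_rw [h1]
  rw [Summable.tsum_finsetSum fun _ _ => ENNReal.summable]
  exact Finset.sum_congr rfl fun k _ => tsum_ite_eq _ _

open Classical in
theorem exitRate_le {r : E → E → ℝ≥0∞} {x : E} {τ : ι → E} {c : ι → ℝ} (hc : ∀ k, 0 ≤ c k)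
    (hr : ∀ y ≠ x, r x y = ∑ k, if y = τ k then ENNReal.ofReal (c k) else 0) :
    exitRate r x ≤ ∑ k, ENNReal.ofReal (c k) := by
  have h := tsum_offDiag_mul hr fun _ => 1
  simp only [mul_one] at h
  rw [exitRate, h]
  refine Finset.sum_le_sum fun k _ => ENNReal.ofReal_le_ofReal ?_
  split_ifs
  exacts [hc k, le_rfl]

open Classical in
-- Passage from a real drift condition to its subtraction-free form in `ℝ≥0∞`. Self-loops may be
-- kept in the hypothesis because their increments vanish.
theorem tsum_offDiag_mul_add_one_le {r : E → E → ℝ≥0∞} {x : E} {τ : ι → E} {c : ι → ℝ}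
    (hc : ∀ k, 0 ≤ c k)
    (hr : ∀ y ≠ x, r x y = ∑ k, if y = τ k then ENNReal.ofReal (c k) else 0)
    {U : E → ℝ} (hU : ∀ y, 0 ≤ U y) (h : ∑ k, c k * (U (τ k) - U x) ≤ -1) :
    ∑' y, offDiag r x y * ENNReal.ofReal (U y) + 1 ≤ exitRate r x * ENNReal.ofReal (U x) := by
  have h1 := tsum_offDiag_mul hr fun _ => 1
  simp only [mul_one] at h1
  have hc' : ∀ k, 0 ≤ if τ k = x then 0 else c k := fun k => by
    split_ifs
    exacts [le_rfl, hc k]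
  rw [tsum_offDiag_mul hr, exitRate, h1, Finset.sum_mul]
  simp_rw [← ENNReal.ofReal_mul (hc' _)]
  rw [← ENNReal.ofReal_sum_of_nonneg fun k _ => mul_nonneg (hc' k) (hU _),
    ← ENNReal.ofReal_sum_of_nonneg fun k _ => mul_nonneg (hc' k) (hU _), ← ENNReal.ofReal_one,
    ← ENNReal.ofReal_add (Finset.sum_nonneg fun k _ => mul_nonneg (hc' k) (hU _)) zero_le_one]
  refine ENNReal.ofReal_le_ofReal ?_
  have h2 : ∑ k, c k * (U (τ k) - U x) = ∑ k, (if τ k = x then 0 else c k) * U (τ k) -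
      ∑ k, (if τ k = x then 0 else c k) * U x := by
    rw [← Finset.sum_sub_distrib]
    refine Finset.sum_congr rfl fun k _ => ?_
    split_ifs with hk
    · rw [hk]; ring
    · ring
  linarith

end CTMC

/-! ### Transitions of the network -/

namespace NetState

variable {V : Type*} [DecidableEq V] {G : SimpleGraph V}

theorem arrive_apply (Q : V → ℕ) (j i : V) :
    arrive Q j i = if i = j then Q i + 1 else Q i := by
  rw [arrive, Function.update_apply]
  split_ifs with h <;> simp [h]

theorem depart_apply (Q : V → ℕ) (j i : V) :
    depart Q j i = if i = j then Q i - 1 else Q i := by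
  rw [depart, Function.update_apply]
  split_ifs <;> simp_all

theorem indep_insert {s : NetState G} {j : V} (h : s.Unblocked j) :
    G.IsIndepSet ((insert j s.active : Finset V) : Set V) := by
  intro a ha b hb hab
  simp only [Finset.coe_insert, Set.mem_insert_iff, Finset.mem_coe] at ha hb
  rcases ha with rfl | ha <;> rcases hb with rfl | hb
  · exact absurd rfl hab
  · exact h.2 b hb
  · exact fun hadj => h.2 a ha hadj.symm
  · exact s.indep ha hb hab

theorem indep_erase (s : NetState G) (j : V) :
    G.IsIndepSet ((s.active.erase j : Finset V) : Set V) :=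
  s.indep.mono (by simp)

open Classical in
/-- The four transitions triggered by node `j`: arrival, activation, completion followed by a
back-off period, completion followed by another transmission. A transition that is not possible in
the state `s` leaves it unchanged. -/
def move (s : NetState G) (j : V) : Fin 4 → NetState G :=
  ![⟨s.active, s.indep, arrive s.queue j⟩,
    if h : s.Unblocked j then ⟨insert j s.active, indep_insert h, depart s.queue j⟩ else s,
    ⟨s.active.erase j, s.indep_erase j, s.queue⟩,
    if j ∈ s.active then ⟨s.active, s.indep, depart s.queue j⟩ else s]

/-- Rates of the four transitions triggered by a node. -/
def moveRate (lam mu nu p : ℝ) : Fin 4 → ℝ := ![lam, nu, p * mu, (1 - p) * mu]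

theorem moveRate_nonneg {lam mu nu p : ℝ} (hlam : 0 < lam) (hmu : 0 < mu) (hnu : 0 < nu)
    (hp : 0 < p) (hp1 : p ≤ 1) (k : Fin 4) : 0 ≤ moveRate lam mu nu p k := by
  have h1 : 0 ≤ (1 - p) * mu := mul_nonneg (by linarith) hmu.le
  have h2 : 0 ≤ p * mu := by positivity
  fin_cases k <;> simp [moveRate] <;> linarith

open Classical in
-- Impossible transitions are self-loops of `move`, hence invisible when `s' ≠ s`.
theorem networkRate_eq_sum_move [Fintype V] (lam mu nu p : ℝ) (s s' : NetState G) (h : s' ≠ s) :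
    networkRate G lam mu nu p s s' = ∑ jk : V × Fin 4,
      if s' = s.move jk.1 jk.2 then ENNReal.ofReal (moveRate lam mu nu p jk.2) else 0 := by
  rw [Fintype.sum_prod_type, networkRate]
  refine Finset.sum_congr rfl fun j _ => ?_
  rw [Fin.sum_univ_four]
  congr 1
  · congr 1
    · congr 1
      · simp [move, moveRate, NetState.ext_iff]
      · by_cases hj : s.Unblocked j
        · simp [move, moveRate, NetState.ext_iff, hj]
        · simp [move, hj, h]
    · by_cases hj : j ∈ s.active
      · simp [move, moveRate, NetState.ext_iff, hj]
      · have : s' ≠ s.move j 2 := by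
          rw [show s.move j 2 = s from NetState.ext (Finset.erase_eq_of_notMem hj) rfl]
          exact h
        simp [this, hj]
  · by_cases hj : j ∈ s.active
    · simp [move, moveRate, NetState.ext_iff, hj]
    · simp [move, hj, h]

open Classical in
/-- Generator of the network, applied to the function `f` at the state `s`. -/
def generator [Fintype V] (lam mu nu p : ℝ) (f : NetState G → ℝ) (s : NetState G) : ℝ :=
  ∑ jk : V × Fin 4, moveRate lam mu nu p jk.2 * (f (s.move jk.1 jk.2) - f s)

end NetState

/-- Foster's criterion. Let `g` be a function of the active nodes and the queue length at `i` that
determines this queue length. If for every value of (active nodes, queue length at `i`) there is a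
nonnegative function of them whose generator is at most `-1` off that value, then `g` is positive
recurrent. -/
theorem NetState.positiveRecurrent_of_generator_le {V F : Type*} [Fintype V] [DecidableEq V]
    {G : SimpleGraph V} {lam mu nu p : ℝ} (hlam : 0 < lam) (hmu : 0 < mu) (hnu : 0 < nu)
    (hp : 0 < p) (hp1 : p ≤ 1) {i : V} {g : NetState G → F}
    (hg : ∀ s t, g s = g t → s.queue i = t.queue i)
    (hg' : ∀ s t, s.active = t.active → s.queue i = t.queue i → g s = g t)
    (h : ∀ t : NetState G, ∃ W : Finset V → ℕ → ℝ, (∀ X q, 0 ≤ W X q) ∧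
      ∀ s : NetState G, ¬ (s.active = t.active ∧ s.queue i = t.queue i) →
        generator lam mu nu p (fun u => W u.active (u.queue i)) s ≤ -1) :
    CTMC.PositiveRecurrent (networkRate G lam mu nu p) g := by
  classical
  intro x y
  obtain ⟨W, hW0, hW⟩ := h y
  -- One transition out of the fibre raises the queue by at most one, so `M` bounds `W` wherever the
  -- fibre can be left to.
  obtain ⟨M, hM⟩ : ∃ M, ∀ X : Finset V, ∀ q ≤ y.queue i + 1, W X q ≤ M := by
    obtain ⟨M, hM⟩ := ((Set.finite_univ (α := Finset V)).prod
      (Set.finite_Iic (y.queue i + 1))).image (fun z => W z.1 z.2) |>.bddAbove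
    exact ⟨M, fun X q hq => hM ⟨(X, q), ⟨Set.mem_univ _, hq⟩, rfl⟩⟩
  have hM0 : 0 ≤ M := (hW0 ∅ 0).trans (hM ∅ 0 (by omega))
  have hlam' : 0 < 1 / lam := by positivity
  have hrate := moveRate_nonneg hlam hmu hnu hp hp1
  -- Every exit from the fibre lowers `f₀` by at least 1/λ, and an arrival at `i`, of rate λ, is
  -- always an exit: the drift on the fibre is at most -1.
  let f₀ : NetState G → ℝ := fun u => if g u = g y then M + 1 / lam else W u.active (u.queue i)
  let f₁ : NetState G → ℝ := fun u => if g u = g y then 0 else W u.active (u.queue i)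
  have hqueue : ∀ (s : NetState G) j k, (s.move j k).queue i ≤ s.queue i + 1 := by
    intro s j k
    fin_cases k <;> simp only [move] <;> simp
    · rw [arrive_apply]; split_ifs <;> omega
    · split_ifs
      · simp only [depart_apply]; split_ifs <;> omega
      · omega
    · split_ifs
      · simp only [depart_apply]; split_ifs <;> omega
      · omega
  have hf₀ : ∀ u, 0 ≤ f₀ u := fun u => by
    simp only [f₀]; split_ifs
    exacts [by positivity, hW0 _ _]
  have hf₁ : ∀ u, 0 ≤ f₁ u := fun u => by
    simp only [f₁]; split_ifs
    exacts [le_rfl, hW0 _ _]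
  refine CTMC.expect_returnTime_lt_top (R := ∑ jk : V × Fin 4,
      ENNReal.ofReal (moveRate lam mu nu p jk.2)) (by simp)
    (fun s => CTMC.exitRate_le (fun jk : V × Fin 4 => hrate jk.2)
      (networkRate_eq_sum_move lam mu nu p s))
    (U₀ := fun u => ENNReal.ofReal (f₀ u)) (U₁ := fun u => ENNReal.ofReal (f₁ u))
    (fun s hs => ?_) (fun s hs => ?_) (fun s hs => by simp [f₁, hs])
    (fun s hs => by simp [f₀, f₁, hs]) ENNReal.ofReal_ne_top
  · refine CTMC.tsum_offDiag_mul_add_one_le (fun jk : V × Fin 4 => hrate jk.2)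
      (networkRate_eq_sum_move lam mu nu p s) hf₀ ?_
    have hdrop : ∀ u : NetState G, u.queue i ≤ s.queue i + 1 → g u ≠ g y →
        f₀ u - f₀ s ≤ -(1 / lam) := by
      intro u hu hgu
      have := hM u.active (u.queue i) (hg s y hs ▸ hu)
      simp only [f₀, if_pos hs, if_neg hgu]
      linarith
    have hle : ∀ jk : V × Fin 4, moveRate lam mu nu p jk.2 * (f₀ (s.move jk.1 jk.2) - f₀ s) ≤ 0 := by
      intro jk
      refine mul_nonpos_of_nonneg_of_nonpos (hrate _) ?_
      by_cases hgu : g (s.move jk.1 jk.2) = g y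
      · simp [f₀, hgu, hs]
      · linarith [hdrop _ (hqueue s jk.1 jk.2) hgu]
    rw [← Finset.add_sum_erase _ _ (Finset.mem_univ (i, (0 : Fin 4)))]
    refine (add_le_of_nonpos_right (Finset.sum_nonpos fun jk _ => hle jk)).trans ?_
    have h3 := hdrop (s.move i 0) (hqueue s i 0) fun hcon => by
      have := hg _ _ (hcon.trans hs.symm)
      simp [move, arrive] at this
    calc lam * (f₀ (s.move i 0) - f₀ s) ≤ lam * -(1 / lam) := by gcongr
      _ = -1 := by field_simp
  · refine CTMC.tsum_offDiag_mul_add_one_le (fun jk : V × Fin 4 => hrate jk.2)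
      (networkRate_eq_sum_move lam mu nu p s) hf₁ ?_
    -- Replacing `W` by 0 on the fibre only lowers the targets of the jumps, hence the drift off the
    -- fibre.
    refine le_trans (Finset.sum_le_sum fun jk _ => ?_) (hW s fun hcon => hs (hg' _ _ hcon.1 hcon.2))
    refine mul_le_mul_of_nonneg_left ?_ (hrate _)
    simp only [f₁, if_neg hs]
    split_ifs
    · linarith [hW0 (s.move jk.1 jk.2).active ((s.move jk.1 jk.2).queue i)]
    · exact le_rfl

/-! ### The hard-core chain and its Poisson equation -/

namespace HardCore

variable {V : Type*} [DecidableEq V]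

open Classical in
/-- The set `X` after an attempt of `j` to become active. -/
def add (G : SimpleGraph V) (X : Finset V) (j : V) : Finset V :=
  if j ∉ X ∧ ∀ k ∈ X, ¬ G.Adj j k then insert j X else X

theorem indep_add {G : SimpleGraph V} {X : Finset V} (hX : G.IsIndepSet (X : Set V)) (j : V) :
    G.IsIndepSet (add G X j : Set V) := by
  unfold add
  split_ifs with h
  · exact NetState.indep_insert (s := ⟨X, hX, 0⟩) h
  · exact hX

theorem indep_erase {G : SimpleGraph V} {X : Finset V} (hX : G.IsIndepSet (X : Set V)) (j : V) :
    G.IsIndepSet (X.erase j : Set V) :=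
  hX.mono (by simp)

variable [Fintype V]

open Classical in
/-- The independent sets of `G`. -/
def indepSets (G : SimpleGraph V) : Finset (Finset V) :=
  Finset.univ.filter fun X => G.IsIndepSet (X : Set V)

theorem mem_indepSets {G : SimpleGraph V} {X : Finset V} :
    X ∈ indepSets G ↔ G.IsIndepSet (X : Set V) := by simp [indepSets]

theorem empty_mem_indepSets (G : SimpleGraph V) : ∅ ∈ indepSets G := by simp [mem_indepSets]

/-- Generator of the hard-core chain with activation rate `ν` and deactivation rate `β`. -/
def gen (G : SimpleGraph V) (ν β : ℝ) (f : Finset V → ℝ) (X : Finset V) : ℝ :=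
  ∑ j, (ν * (f (add G X j) - f X) + β * (f (X.erase j) - f X))

/-- Detailed balance: the nonzero terms are matched by X ↦ X ∪ {j}, and σ^|X| σ = σ^|X ∪ {j}|. -/
theorem sum_weight_mul_add {G : SimpleGraph V} (σ : ℝ) (f : Finset V → ℝ) (j : V) :
    ∑ X ∈ indepSets G, σ ^ X.card * (σ * (f (add G X j) - f X)) =
      ∑ X ∈ indepSets G, σ ^ X.card * (f X - f (X.erase j)) := by
  classical
  have hl : ∀ X ∈ indepSets G, σ ^ X.card * (σ * (f (add G X j) - f X)) ≠ 0 →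
      (j ∉ X ∧ ∀ k ∈ X, ¬ G.Adj j k) := by
    intro X _ h
    by_contra hcon
    rw [add, if_neg hcon] at h
    simp at h
  have hr : ∀ X ∈ indepSets G, σ ^ X.card * (f X - f (X.erase j)) ≠ 0 → j ∈ X := by
    intro X _ h
    by_contra hcon
    rw [Finset.erase_eq_of_notMem hcon] at h
    simp at h
  rw [← Finset.sum_filter_of_ne hl, ← Finset.sum_filter_of_ne hr]
  refine Finset.sum_nbij' (fun X => insert j X) (fun X => X.erase j) ?_ ?_ ?_ ?_ ?_
  · intro X hX
    simp only [Finset.mem_filter, mem_indepSets] at hX ⊢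
    exact ⟨NetState.indep_insert (s := ⟨X, hX.1, 0⟩) hX.2, Finset.mem_insert_self _ _⟩
  · intro X hX
    simp only [Finset.mem_filter, mem_indepSets] at hX ⊢
    refine ⟨indep_erase hX.1 j, Finset.notMem_erase _ _, fun k hk => ?_⟩
    exact hX.1 hX.2 (Finset.mem_of_mem_erase hk) (Finset.ne_of_mem_erase hk).symm
  · intro X hX
    exact Finset.erase_insert (Finset.mem_filter.1 hX).2.1
  · intro X hX
    exact Finset.insert_erase (Finset.mem_filter.1 hX).2
  · intro X hX
    have h := (Finset.mem_filter.1 hX).2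
    rw [add, if_pos h, Finset.card_insert_of_notMem h.1, Finset.erase_insert h.1]
    ring

theorem sum_weight_mul_gen (G : SimpleGraph V) (σ β : ℝ) (f : Finset V → ℝ) :
    ∑ X ∈ indepSets G, σ ^ X.card * gen G (σ * β) β f X = 0 := by
  simp_rw [gen, Finset.mul_sum]
  rw [Finset.sum_comm]
  refine Finset.sum_eq_zero fun j _ => ?_
  have h := sum_weight_mul_add (G := G) σ f j
  calc _ = β * (∑ X ∈ indepSets G, σ ^ X.card * (σ * (f (add G X j) - f X)) -
        ∑ X ∈ indepSets G, σ ^ X.card * (f X - f (X.erase j))) := by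
        rw [← Finset.sum_sub_distrib, Finset.mul_sum]
        exact Finset.sum_congr rfl fun X _ => by ring
    _ = 0 := by rw [h, sub_self, mul_zero]

theorem gen_neg (G : SimpleGraph V) (ν β : ℝ) (f : Finset V → ℝ) (X : Finset V) :
    gen G ν β (-f) X = - gen G ν β f X := by
  simp only [gen, ← Finset.sum_neg_distrib, Pi.neg_apply]
  exact Finset.sum_congr rfl fun j _ => by ring

/-- Maximum principle: a harmonic function is largest at the empty set. -/
theorem le_empty_of_gen_eq_zero {G : SimpleGraph V} {ν β : ℝ} (hν : 0 < ν) (hβ : 0 < β)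
    {f : Finset V → ℝ} (hf : ∀ X ∈ indepSets G, gen G ν β f X = 0) :
    ∀ X ∈ indepSets G, f X ≤ f ∅ := by
  obtain ⟨Y, hY, hmax⟩ := (indepSets G).exists_max_image f ⟨∅, empty_mem_indepSets G⟩
  -- At a maximizer all terms of the generator are nonpositive and sum to zero, so each vanishes.
  -- Since β > 0, erasing a vertex gives another maximizer, and the descent ends at the empty set.
  have key : ∀ n, ∀ X ∈ indepSets G, X.card = n → f X = f Y → f ∅ = f Y := by
    intro n
    induction n with
    | zero => intro X _ hn hX; rw [← hX, Finset.card_eq_zero.1 hn]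
    | succ n ih =>
      intro X hX hn hXY
      obtain ⟨j, hj⟩ : X.Nonempty := Finset.card_pos.1 (by omega)
      have hXi := mem_indepSets.1 hX
      have hle : ∀ k ∈ Finset.univ,
          ν * (f (add G X k) - f X) + β * (f (X.erase k) - f X) ≤ 0 := by
        intro k _
        have h1 := hmax _ (mem_indepSets.2 (indep_add hXi k))
        have h2 := hmax _ (mem_indepSets.2 (indep_erase hXi k))
        rw [← hXY] at h1 h2
        nlinarith
      have h0 := (Finset.sum_eq_zero_iff_of_nonpos hle).1 (hf X hX) j (Finset.mem_univ j)
      have h1 := hmax _ (mem_indepSets.2 (indep_add hXi j))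
      have h2 := hmax _ (mem_indepSets.2 (indep_erase hXi j))
      refine ih (X.erase j) (mem_indepSets.2 (indep_erase hXi j))
        (by rw [Finset.card_erase_of_mem hj]; omega) ?_
      rw [← hXY] at h1 h2 ⊢
      nlinarith
  intro X hX
  rw [key _ Y hY rfl rfl]
  exact hmax X hX

theorem eq_empty_of_gen_eq_zero {G : SimpleGraph V} {ν β : ℝ} (hν : 0 < ν) (hβ : 0 < β)
    {f : Finset V → ℝ} (hf : ∀ X ∈ indepSets G, gen G ν β f X = 0) :
    ∀ X ∈ indepSets G, f X = f ∅ := by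
  intro X hX
  refine le_antisymm (le_empty_of_gen_eq_zero hν hβ hf X hX) ?_
  have := le_empty_of_gen_eq_zero (f := -f) hν hβ (fun Y hY => by rw [gen_neg, hf Y hY, neg_zero]) X hX
  simpa using this

/-- Weighted sum of the independent sets, each `X` having weight `σ ^ |X|`. -/
def partition (G : SimpleGraph V) (σ : ℝ) : ℝ := ∑ X ∈ indepSets G, σ ^ X.card

/-- Stationary probability that `i` is active. -/
def occupancy (G : SimpleGraph V) (σ : ℝ) (i : V) : ℝ :=
  (∑ X ∈ indepSets G, σ ^ X.card * (if i ∈ X then 1 else 0)) / partition G σ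

theorem partition_pos (G : SimpleGraph V) {σ : ℝ} (hσ : 0 < σ) : 0 < partition G σ :=
  Finset.sum_pos (fun _ _ => by positivity) ⟨∅, empty_mem_indepSets G⟩

/-- The Poisson equation of the hard-core chain is solvable for every function of stationary mean
zero. -/
theorem exists_gen_eq {G : SimpleGraph V} {σ β : ℝ} (hσ : 0 < σ) (hβ : 0 < β) {b : Finset V → ℝ}
    (hb : ∑ X ∈ indepSets G, σ ^ X.card * b X = 0) :
    ∃ f : Finset V → ℝ, ∀ X ∈ indepSets G, gen G (σ * β) β f X = b X := by
  classical
  let Ω := {X : Finset V // X ∈ indepSets G}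
  let ext : (Ω → ℝ) →ₗ[ℝ] (Finset V → ℝ) :=
    { toFun := fun f X => if h : X ∈ indepSets G then f ⟨X, h⟩ else 0
      map_add' := fun f g => by ext X; by_cases h : X ∈ indepSets G <;> simp [h]
      map_smul' := fun c f => by ext X; by_cases h : X ∈ indepSets G <;> simp [h] }
  have hext : ∀ (f : Ω → ℝ) (X : Ω), ext f X.1 = f X := fun f X => by simp [ext]
  let A : (Ω → ℝ) →ₗ[ℝ] (Ω → ℝ) :=
    { toFun := fun f X => gen G (σ * β) β (ext f) X.1
      map_add' := fun f g => by
        ext X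
        simp only [gen, map_add, Pi.add_apply, ← Finset.sum_add_distrib]
        exact Finset.sum_congr rfl fun j _ => by ring
      map_smul' := fun c f => by
        ext X
        simp only [gen, map_smul, Pi.smul_apply, smul_eq_mul, RingHom.id_apply, Finset.mul_sum]
        exact Finset.sum_congr rfl fun j _ => by ring }
  let L : (Ω → ℝ) →ₗ[ℝ] ℝ :=
    { toFun := fun f => ∑ X : Ω, σ ^ X.1.card * f X
      map_add' := fun f g => by simp [mul_add, Finset.sum_add_distrib]
      map_smul' := fun c f => by
        simp only [Pi.smul_apply, smul_eq_mul, RingHom.id_apply, Finset.mul_sum]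
        exact Finset.sum_congr rfl fun j _ => by ring }
  have hsum : ∀ h : Finset V → ℝ, ∑ X : Ω, h X.1 = ∑ X ∈ indepSets G, h X := fun h =>
    Finset.sum_coe_sort (indepSets G) h
  -- Fredholm alternative by dimension count: stationarity puts the range of `A` in the hyperplane
  -- `ker L`, and since harmonic functions are constant the range has codimension at most one.
  have hle : LinearMap.range A ≤ LinearMap.ker L := by
    rintro _ ⟨f, rfl⟩
    change ∑ X : Ω, σ ^ X.1.card * gen G (σ * β) β (ext f) X.1 = 0
    rw [hsum fun X => σ ^ X.card * gen G (σ * β) β (ext f) X]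
    exact sum_weight_mul_gen G σ β _
  have hker : LinearMap.ker A ≤ Submodule.span ℝ {fun _ => (1 : ℝ)} := by
    intro f hf
    rw [Submodule.mem_span_singleton]
    refine ⟨ext f ∅, ?_⟩
    ext X
    have := eq_empty_of_gen_eq_zero (mul_pos hσ hβ) hβ (f := ext f)
      (fun Y hY => congrFun (LinearMap.mem_ker.1 hf) ⟨Y, hY⟩) X.1 X.2
    rw [hext] at this
    simp [this]
  have hkerdim : Module.finrank ℝ (LinearMap.ker A) ≤ 1 :=
    (Submodule.finrank_mono hker).trans ((finrank_span_le_card _).trans (by simp))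
  have hL : LinearMap.range L = ⊤ := by
    refine LinearMap.range_eq_top.2 (LinearMap.surjective fun h0 => ?_)
    have h1 : L (fun _ => 1) = partition G σ := by
      change ∑ X : Ω, σ ^ X.1.card * 1 = _
      rw [hsum fun X => σ ^ X.card * 1, partition]
      simp
    rw [h0] at h1
    exact (partition_pos G hσ).ne h1
  have hA := LinearMap.finrank_range_add_finrank_ker A
  have hLdim := LinearMap.finrank_range_add_finrank_ker L
  rw [hL, finrank_top, Module.finrank_self] at hLdim
  have heq : LinearMap.range A = LinearMap.ker L :=
    Submodule.eq_of_le_of_finrank_le hle (by omega)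
  have hbL : (fun X : Ω => b X.1) ∈ LinearMap.ker L := by
    change ∑ X : Ω, σ ^ X.1.card * b X.1 = 0
    rw [hsum fun X => σ ^ X.card * b X, hb]
  rw [← heq] at hbL
  obtain ⟨f, hf⟩ := hbL
  exact ⟨ext f, fun X hX => congrFun hf ⟨X, hX⟩⟩

theorem exists_gen_eq_indicator_sub_occupancy (G : SimpleGraph V) {σ β : ℝ} (hσ : 0 < σ)
    (hβ : 0 < β) (i : V) :
    ∃ f : Finset V → ℝ, ∀ X ∈ indepSets G,
      gen G (σ * β) β f X = (if i ∈ X then 1 else 0) - occupancy G σ i := by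
  refine exists_gen_eq hσ hβ ?_
  simp_rw [mul_sub]
  rw [Finset.sum_sub_distrib, ← Finset.sum_mul]
  have : partition G σ ≠ 0 := (partition_pos G hσ).ne'
  change _ - partition G σ * _ = 0
  rw [occupancy, mul_div_cancel₀ _ this, sub_self]

/-! ### Occupancy in the regime of fast activation -/

/-- Vertices in the same orbit of the automorphism group are active with the same probability. -/
theorem occupancy_eq_of_iso {G : SimpleGraph V} (e : G ≃g G) (σ : ℝ) (i : V) :
    occupancy G σ (e i) = occupancy G σ i := by
  have hmem : ∀ (e : G ≃g G), ∀ X ∈ indepSets G, X.map e.toEquiv.toEmbedding ∈ indepSets G := by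
    intro e X hX
    rw [mem_indepSets] at hX ⊢
    intro a ha b hb hab
    simp only [Finset.coe_map, Set.mem_image, Finset.mem_coe] at ha hb
    obtain ⟨a, ha, rfl⟩ := ha
    obtain ⟨b, hb, rfl⟩ := hb
    intro hadj
    exact hX ha hb (fun h => hab (by rw [h])) (e.map_adj_iff.1 hadj)
  unfold occupancy
  congr 1
  symm
  refine Finset.sum_nbij' (fun X => X.map e.toEquiv.toEmbedding)
    (fun X => X.map e.symm.toEquiv.toEmbedding) (hmem e) (hmem e.symm) ?_ ?_ ?_
  · intro X _; ext a
    simp only [Finset.mem_map_equiv]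
    exact iff_of_eq (congrArg (· ∈ X) (e.toEquiv.symm_apply_apply a))
  · intro X _; ext a
    simp only [Finset.mem_map_equiv]
    exact iff_of_eq (congrArg (· ∈ X) (e.toEquiv.apply_symm_apply a))
  · intro X _
    have : e i ∈ X.map e.toEquiv.toEmbedding ↔ i ∈ X := by
      rw [Finset.mem_map_equiv]
      exact iff_of_eq (congrArg (· ∈ X) (e.toEquiv.symm_apply_apply i))
    rw [Finset.card_map]
    congr 1
    by_cases h : i ∈ X
    · rw [if_pos h, if_pos (this.2 h)]
    · rw [if_neg h, if_neg (mt this.1 h)]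

theorem sum_occupancy (G : SimpleGraph V) (σ : ℝ) :
    ∑ i, occupancy G σ i = (∑ X ∈ indepSets G, σ ^ X.card * X.card) / partition G σ := by
  unfold occupancy
  rw [← Finset.sum_div, Finset.sum_comm]
  congr 1
  refine Finset.sum_congr rfl fun X _ => ?_
  rw [← Finset.mul_sum]
  simp

/-- With an independent set of `m` vertices, the mean number of active vertices is at least
`m (1 - 2 ^ |V| / σ)`. -/
theorem le_sum_occupancy {G : SimpleGraph V} {σ : ℝ} (hσ : 1 ≤ σ) {Y : Finset V}
    (hY : G.IsIndepSet (Y : Set V)) :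
    Y.card * (1 - 2 ^ Fintype.card V / σ) ≤ ∑ i, occupancy G σ i := by
  have hσ0 : 0 < σ := by linarith
  have hZ := partition_pos G hσ0
  have hYZ : σ ^ Y.card ≤ partition G σ :=
    Finset.single_le_sum (f := fun X : Finset V => σ ^ X.card) (fun X _ => by positivity)
      (mem_indepSets.2 hY)
  -- If X has fewer elements than Y, its weight is at most σ^(|Y|-1) and the left side is
  -- nonpositive; otherwise |Y| ≤ |X|. The total error is then controlled by 2^|V| sets and σ^|Y| ≤
  -- Z, with Z the partition function.
  have hterm : ∀ X ∈ indepSets G,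
      Y.card * (σ ^ X.card - σ ^ Y.card / σ) ≤ σ ^ X.card * X.card := by
    intro X _
    have hm : (0 : ℝ) ≤ Y.card := by positivity
    rcases lt_or_ge X.card Y.card with h | h
    · have h1 : σ ^ X.card ≤ σ ^ Y.card / σ := by
        rw [le_div_iff₀ hσ0, ← pow_succ]
        exact pow_le_pow_right₀ hσ h
      have h2 : (0 : ℝ) ≤ σ ^ X.card * X.card := by positivity
      nlinarith
    · have h1 : (Y.card : ℝ) ≤ X.card := by exact_mod_cast h
      have h2 : 0 ≤ σ ^ Y.card / σ := by positivity
      have h3 : (0 : ℝ) < σ ^ X.card := by positivity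
      nlinarith
  have hcard : ((indepSets G).card : ℝ) ≤ 2 ^ Fintype.card V := by
    have : (indepSets G).card ≤ 2 ^ Fintype.card V := by
      rw [← Fintype.card_finset]; exact Finset.card_le_univ _
    exact_mod_cast this
  rw [sum_occupancy, le_div_iff₀ hZ]
  calc Y.card * (1 - 2 ^ Fintype.card V / σ) * partition G σ
      = Y.card * (partition G σ - 2 ^ Fintype.card V * (partition G σ / σ)) := by ring
    _ ≤ Y.card * (partition G σ - (indepSets G).card * (σ ^ Y.card / σ)) := by gcongr
    _ = ∑ X ∈ indepSets G, Y.card * (σ ^ X.card - σ ^ Y.card / σ) := by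
        rw [← Finset.mul_sum, Finset.sum_sub_distrib, partition]
        simp
    _ ≤ _ := Finset.sum_le_sum hterm

end HardCore

/-! ### The toric grid -/

/-- A step along the cycle flips parity; the wrap-around from L - 1 to 0 does so because L is even.
-/
theorem cycleGraph_adj_val_mod_two_ne {L : ℕ} (hL : Even L) {a b : Fin L}
    (h : (SimpleGraph.cycleGraph L).Adj a b) : a.val % 2 ≠ b.val % 2 := by
  obtain _ | _ | n := L
  · exact a.elim0
  · simp at hL
  have hsucc : ∀ c d : Fin (n + 1 + 1), c - d = 1 → c.val % 2 ≠ d.val % 2 := by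
    intro c d hcd
    have : c = d + 1 := by rw [← hcd]; abel
    rw [this, Fin.val_add_one]
    split_ifs with hd
    · rw [hd, Fin.val_last]
      obtain ⟨k, hk⟩ := hL
      omega
    · omega
  rw [SimpleGraph.cycleGraph_adj] at h
  rcases h with h | h
  · exact hsucc a b h
  · exact (hsucc b a h).symm

theorem toricGrid_adj_mod_two_ne {L : ℕ} (hL : Even L) {a b : Fin L × Fin L}
    (h : (toricGrid L).Adj a b) :
    (a.1.val + a.2.val) % 2 ≠ (b.1.val + b.2.val) % 2 := by
  rw [toricGrid, SimpleGraph.boxProd_adj] at h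
  rcases h with ⟨h, h'⟩ | ⟨h, h'⟩
  · have := cycleGraph_adj_val_mod_two_ne hL h
    rw [h']; omega
  · have := cycleGraph_adj_val_mod_two_ne hL h
    rw [h']; omega

/-- One of the two parity classes of an even toric grid is an independent set with at least half of
the vertices. -/
theorem exists_isIndepSet_toricGrid {L : ℕ} (hL : Even L) :
    ∃ Y : Finset (Fin L × Fin L), (toricGrid L).IsIndepSet (Y : Set (Fin L × Fin L)) ∧
      L * L ≤ 2 * Y.card := by
  have hind : ∀ e, (toricGrid L).IsIndepSet
      ((Finset.univ.filter fun a : Fin L × Fin L => (a.1.val + a.2.val) % 2 = e :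
        Finset (Fin L × Fin L)) : Set (Fin L × Fin L)) := by
    intro e a ha b hb _ hadj
    simp only [Finset.coe_filter, Finset.mem_univ, true_and, Set.mem_ofPred_eq] at ha hb
    exact toricGrid_adj_mod_two_ne hL hadj (ha.trans hb.symm)
  have hcard := Finset.card_filter_add_card_filter_not (s := Finset.univ)
    (fun a : Fin L × Fin L => (a.1.val + a.2.val) % 2 = 0)
  have hodd : (Finset.univ.filter fun a : Fin L × Fin L => ¬ (a.1.val + a.2.val) % 2 = 0) =
      Finset.univ.filter fun a : Fin L × Fin L => (a.1.val + a.2.val) % 2 = 1 :=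
    Finset.filter_congr fun a _ => by omega
  rw [hodd, Finset.card_univ, Fintype.card_prod, Fintype.card_fin] at hcard
  rcases le_total (L * L) (2 * (Finset.univ.filter fun a : Fin L × Fin L =>
      (a.1.val + a.2.val) % 2 = 0).card) with h | h
  · exact ⟨_, hind 0, h⟩
  · exact ⟨_, hind 1, by omega⟩

/-- The toric grid is vertex transitive. -/
theorem exists_toricGrid_iso {L : ℕ} (i j : Fin L × Fin L) :
    ∃ e : toricGrid L ≃g toricGrid L, e i = j := by
  obtain _ | n := L
  · exact i.1.elim0
  let e : toricGrid (n + 1) ≃g toricGrid (n + 1) :=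
    { toEquiv := Equiv.addRight (j - i)
      map_rel_iff' := by
        intro a b
        simp only [toricGrid, SimpleGraph.boxProd_adj, Equiv.coe_addRight, Prod.fst_add,
          Prod.snd_add, SimpleGraph.cycleGraph_eq_circulantGraph,
          SimpleGraph.circulantGraph_adj_translate, add_left_inj] }
  exact ⟨e, add_sub_cancel i j⟩

/-- Transitivity makes the occupancy equal to its average over the L² vertices. The bound `hσL`
makes the factor 1 - 2^(L²)/σ nonnegative, so that |Y| may be replaced by L²/2. -/
theorem le_occupancy_toricGrid {L : ℕ} (hL : Even L) {σ : ℝ} (hσ : 1 ≤ σ)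
    (hσL : 2 ^ (L * L) ≤ σ) (i : Fin L × Fin L) :
    (1 - 2 ^ (L * L) / σ) / 2 ≤ HardCore.occupancy (toricGrid L) σ i := by
  obtain ⟨Y, hY, hcard⟩ := exists_isIndepSet_toricGrid hL
  have h := HardCore.le_sum_occupancy hσ hY
  have hconst : ∀ j, HardCore.occupancy (toricGrid L) σ j = HardCore.occupancy (toricGrid L) σ i := by
    intro j
    obtain ⟨e, rfl⟩ := exists_toricGrid_iso i j
    exact HardCore.occupancy_eq_of_iso e σ i
  simp only [hconst, Finset.sum_const, Finset.card_univ, Fintype.card_prod, Fintype.card_fin,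
    nsmul_eq_mul] at h
  have hLpos : 0 < L := i.1.pos
  have hcard' : ((L * L : ℕ) : ℝ) ≤ 2 * Y.card := by exact_mod_cast hcard
  have h1 : 0 ≤ 1 - 2 ^ (L * L) / σ := by
    rw [sub_nonneg, div_le_one (by linarith)]; exact hσL
  have hLL : (0 : ℝ) < ((L * L : ℕ) : ℝ) := by exact_mod_cast Nat.mul_pos hLpos hLpos
  refine le_of_mul_le_mul_left (le_trans ?_ h) hLL
  nlinarith

/-! ### Lyapunov functions of the network -/

namespace NetState

variable {V : Type*} [DecidableEq V] {G : SimpleGraph V}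

open Classical in
/-- Number of transitions that suffice to bring the active nodes and the queue length at `i` from
`(X, q)` to `(X₀, q₀)`: deactivate all nodes, adjust the queue length, activate `X₀`. -/
def stepsTo (i : V) (X₀ : Finset V) (q₀ : ℕ) (X : Finset V) (q : ℕ) : ℕ :=
  -- In this branch only activations remain; that of `i` will consume one packet, whence the extra
  -- 1. In the other branch a surplus packet costs two transitions (activate and deactivate `i`) and
  -- a missing one costs a single arrival.
  if X ⊆ X₀ ∧ q = q₀ + (if i ∈ X₀ \ X then 1 else 0) then (X₀ \ X).card
  else X.card + X₀.card + 2 * (q - (q₀ + if i ∈ X₀ then 1 else 0)) +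
    ((q₀ + if i ∈ X₀ then 1 else 0) - q)

/-- Transition 3 is excluded because its rate (1 - p)μ vanishes for p = 1; the other three always
have positive rate. -/
theorem exists_move_stepsTo_lt (i : V) (t s : NetState G)
    (h : ¬ (s.active = t.active ∧ s.queue i = t.queue i)) :
    ∃ j, ∃ k : Fin 4, k ≠ 3 ∧
      stepsTo i t.active (t.queue i) (s.move j k).active ((s.move j k).queue i) <
        stepsTo i t.active (t.queue i) s.active (s.queue i) := by
  classical
  have hle : ∀ X : Finset V, (t.active \ X).card ≤ t.active.card := fun X =>
    Finset.card_le_card Finset.sdiff_subset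
  by_cases hfin : s.active ⊆ t.active ∧
      s.queue i = t.queue i + (if i ∈ t.active \ s.active then 1 else 0)
  · obtain ⟨hsub, hq⟩ := hfin
    have hne : (t.active \ s.active).Nonempty := by
      rw [Finset.nonempty_iff_ne_empty]
      intro hem
      rw [hem] at hq
      exact h ⟨Finset.Subset.antisymm hsub (Finset.sdiff_eq_empty_iff_subset.1 hem), by simpa using hq⟩
    obtain ⟨j, hj⟩ := hne
    rw [Finset.mem_sdiff] at hj
    have hunb : s.Unblocked j := ⟨hj.2, fun k hk =>
      t.indep hj.1 (hsub hk) fun hjk => hj.2 (hjk ▸ hk)⟩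
    refine ⟨j, 1, by decide, ?_⟩
    have hmove : s.move j 1 = ⟨insert j s.active, indep_insert hunb, depart s.queue j⟩ := by
      simp [move, hunb]
    have hins : insert j s.active ⊆ t.active := Finset.insert_subset hj.1 hsub
    have hlt : (t.active \ insert j s.active).card < (t.active \ s.active).card := by
      refine Finset.card_lt_card (Finset.ssubset_iff_of_subset
        (Finset.sdiff_subset_sdiff le_rfl (Finset.subset_insert _ _)) |>.2
        ⟨j, Finset.mem_sdiff.2 hj, by simp⟩)
    have hq' : depart s.queue j i =
        t.queue i + (if i ∈ t.active \ insert j s.active then 1 else 0) := by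
      rw [depart_apply]
      by_cases hij : i = j
      · subst hij
        rw [if_pos rfl, hq, if_pos (Finset.mem_sdiff.2 hj)]
        simp
      · rw [if_neg hij, hq]
        simp [hij]
    rw [hmove, stepsTo, if_pos ⟨hins, hq'⟩, stepsTo, if_pos ⟨hsub, hq⟩]
    exact hlt
  · set N := stepsTo i t.active (t.queue i) s.active (s.queue i) with hN
    rw [stepsTo, if_neg hfin] at hN
    rcases s.active.eq_empty_or_nonempty with hem | ⟨j, hj⟩
    · rw [hem] at hfin hN
      simp only [Finset.empty_subset, Finset.sdiff_empty, true_and, Finset.card_empty] at hfin hN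
      rcases lt_or_gt_of_ne hfin with hlt | hgt
      · refine ⟨i, 0, by decide, ?_⟩
        have h1 : (s.move i 0).active = ∅ := hem
        have h2 : (s.move i 0).queue i = s.queue i + 1 := by
          simp [move, arrive_apply]
        rw [h1, h2, stepsTo]
        simp only [Finset.empty_subset, Finset.sdiff_empty, true_and, Finset.card_empty]
        split_ifs at hlt hN ⊢ <;> omega
      · refine ⟨i, 1, by decide, ?_⟩
        have hunb : s.Unblocked i := by simp [Unblocked, hem]
        have h1 : (s.move i 1).active = {i} := by simp [move, hunb, hem]
        have h2 : (s.move i 1).queue i = s.queue i - 1 := by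
          simp [move, hunb, depart_apply]
        rw [h1, h2, stepsTo]
        have := hle {i}
        simp only [Finset.card_singleton]
        split_ifs at hgt hN ⊢ <;> omega
    · refine ⟨j, 2, by decide, ?_⟩
      change stepsTo i t.active (t.queue i) (s.active.erase j) (s.queue i) < N
      have hcard : (s.active.erase j).card + 1 = s.active.card := Finset.card_erase_add_one hj
      have := hle (s.active.erase j)
      rw [stepsTo]
      generalize (if i ∈ t.active then 1 else 0) = δ at hN ⊢
      split_ifs <;> omega

variable [Fintype V]

open Classical in
theorem generator_eq (lam mu nu p : ℝ) (f : Finset V → ℕ → ℝ) (i : V)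
    (s : NetState G) :
    generator lam mu nu p (fun u => f u.active (u.queue i)) s = ∑ j,
      (lam * (f s.active (if i = j then s.queue i + 1 else s.queue i) - f s.active (s.queue i)) +
        nu * (f (HardCore.add G s.active j) (if i = j ∧ s.Unblocked j then s.queue i - 1
          else s.queue i) - f s.active (s.queue i)) +
        p * mu * (f (s.active.erase j) (s.queue i) - f s.active (s.queue i)) +
        (1 - p) * mu * (f s.active (if i = j ∧ j ∈ s.active then s.queue i - 1
          else s.queue i) - f s.active (s.queue i))) := by
  rw [generator, Fintype.sum_prod_type]
  refine Finset.sum_congr rfl fun j _ => ?_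
  rw [Fin.sum_univ_four]
  congr 1
  · congr 1
    · congr 1
      · simp [move, moveRate, arrive_apply]
      · by_cases hj : s.Unblocked j
        · have : HardCore.add G s.active j = insert j s.active := if_pos hj
          simp [move, moveRate, hj, depart_apply, this]
        · have : HardCore.add G s.active j = s.active := if_neg hj
          simp [move, moveRate, hj, this]
  · by_cases hj : j ∈ s.active
    · simp [move, moveRate, hj, depart_apply]
    · simp [move, moveRate, hj]

/-- The number of packets at `i`, including the one being transmitted, increases at rate `lam` and
decreases at rate `mu` while `i` is active, up to a correction when the queue is empty. -/
theorem generator_queue_le {lam mu nu p : ℝ} (hmu : 0 < mu) (hnu : 0 < nu)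
    (hp : 0 < p) (hp1 : p ≤ 1) (i : V) (s : NetState G) :
    generator lam mu nu p (fun u => (u.queue i : ℝ) + if i ∈ u.active then 1 else 0) s ≤
      lam - mu * (if i ∈ s.active then 1 else 0) + if s.queue i = 0 then nu + mu else 0 := by
  rw [generator_eq lam mu nu p (fun X q => (q : ℝ) + if i ∈ X then 1 else 0) i s,
    ← Finset.add_sum_erase _ _ (Finset.mem_univ i), Finset.sum_eq_zero, add_zero]
  -- With a waiting packet, activation moves it from the queue into service and leaves the count
  -- unchanged. Dummy packets break this: an activation then adds one, and a repeated transmission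
  -- removes nothing. The term ν + μ covers both.
  · have hpm : 0 ≤ (1 - p) * mu := mul_nonneg (by linarith) hmu.le
    have hpm' : 0 < p * mu := by positivity
    by_cases hi : i ∈ s.active
    · have hb : ¬ s.Unblocked i := fun h => h.1 hi
      have ha : HardCore.add G s.active i = s.active := if_neg hb
      rcases Nat.eq_zero_or_pos (s.queue i) with hq | hq
      · simp [hi, hb, ha, hq]; linarith
      · simp [hi, hb, ha, hq.ne', Nat.cast_pred hq]; linarith
    · by_cases hb : s.Unblocked i
      · have ha : HardCore.add G s.active i = insert i s.active := if_pos hb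
        rcases Nat.eq_zero_or_pos (s.queue i) with hq | hq
        · simp [hi, hb, ha, hq]; linarith
        · simp [hi, hb, ha, hq.ne', Nat.cast_pred hq]
      · have ha : HardCore.add G s.active i = s.active := if_neg hb
        rcases Nat.eq_zero_or_pos (s.queue i) with hq | hq
        · simp [hi, hb, ha, hq]; linarith
        · simp [hi, hb, ha, hq.ne']
  · intro j hj
    have hij : i ≠ j := (Finset.ne_of_mem_erase hj).symm
    have h1 : i ∈ HardCore.add G s.active j ↔ i ∈ s.active := by
      unfold HardCore.add; split_ifs <;> simp [hij]
    simp [hij, h1]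

/-- The active set is an autonomous Markov chain: arrivals and repeated transmissions do not change
it. -/
theorem generator_active (lam mu nu p : ℝ) (f : Finset V → ℝ) (s : NetState G) :
    generator lam mu nu p (fun u => f u.active) s = HardCore.gen G nu (p * mu) f s.active := by
  classical
  rw [generator, Fintype.sum_prod_type, HardCore.gen]
  refine Finset.sum_congr rfl fun j _ => ?_
  rw [Fin.sum_univ_four]
  have h0 : (s.move j 0).active = s.active := rfl
  have h1 : (s.move j 1).active = HardCore.add G s.active j := by
    by_cases hj : s.Unblocked j
    · have : HardCore.add G s.active j = insert j s.active := if_pos hj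
      simp [move, hj, this]
    · have : HardCore.add G s.active j = s.active := if_neg hj
      simp [move, hj, this]
  have h2 : (s.move j 2).active = s.active.erase j := rfl
  have h3 : (s.move j 3).active = s.active := by
    by_cases hj : j ∈ s.active <;> simp [move, hj]
  rw [h0, h1, h2, h3]
  simp [moveRate]

theorem generator_add (lam mu nu p : ℝ) (f g : NetState G → ℝ) (s : NetState G) :
    generator lam mu nu p (fun u => f u + g u) s =
      generator lam mu nu p f s + generator lam mu nu p g s := by
  simp only [generator, ← Finset.sum_add_distrib]
  exact Finset.sum_congr rfl fun _ _ => by ring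

theorem generator_const_mul_add (lam mu nu p c d : ℝ) (f : NetState G → ℝ) (s : NetState G) :
    generator lam mu nu p (fun u => c * f u + d) s = c * generator lam mu nu p f s := by
  simp only [generator, Finset.mul_sum]
  exact Finset.sum_congr rfl fun _ _ => by ring

/-- A bounded function of `(X, Q i)` with negative drift off a given value. -/
theorem exists_bounded_generator_le {lam mu nu p : ℝ} (hlam : 0 < lam) (hmu : 0 < mu) (hnu : 0 < nu)
    (hp : 0 < p) (hp1 : p ≤ 1) (i : V) (t : NetState G) :
    ∃ θ : ℝ, 0 < θ ∧ θ < 1 ∧ ∀ s : NetState G,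
      ¬ (s.active = t.active ∧ s.queue i = t.queue i) →
      generator lam mu nu p
        (fun u => 1 - θ ^ stepsTo i t.active (t.queue i) u.active (u.queue i)) s ≤
        - θ ^ stepsTo i t.active (t.queue i) s.active (s.queue i) := by
  classical
  have hrate := moveRate_nonneg hlam hmu hnu hp hp1
  set R : ℝ := ∑ jk : V × Fin 4, moveRate lam mu nu p jk.2 with hR
  set m : ℝ := min lam (min nu (p * mu)) with hm
  have hm0 : 0 < m := lt_min hlam (lt_min hnu (by positivity))
  have hmk : ∀ k : Fin 4, k ≠ 3 → m ≤ moveRate lam mu nu p k := by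
    intro k hk
    fin_cases k
    · exact min_le_left _ _
    · exact (min_le_right _ _).trans (min_le_left _ _)
    · exact (min_le_right _ _).trans (min_le_right _ _)
    · simp at hk
  have hmR : m ≤ R := (hmk 0 (by decide)).trans
    (Finset.single_le_sum (f := fun jk : V × Fin 4 => moveRate lam mu nu p jk.2)
      (fun jk _ => hrate jk.2) (Finset.mem_univ (i, 0)))
  have hR1 : 0 < R + 1 := by linarith
  -- Some transition of rate at least m lowers d, gaining at least m θ^(d-1) = (R + 1) θ^d, while
  -- the total loss is R θ^d. The `+ 1` leaves a drift of -θ^d.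
  set θ : ℝ := m / (R + 1) with hθ
  have hθ0 : 0 < θ := by positivity
  have hθ1 : θ < 1 := by rw [hθ, div_lt_one hR1]; linarith
  refine ⟨θ, hθ0, hθ1, fun s hs => ?_⟩
  obtain ⟨j, k, hk, hlt⟩ := exists_move_stepsTo_lt i t s hs
  set d : NetState G → ℕ := fun u => stepsTo i t.active (t.queue i) u.active (u.queue i) with hd
  change ∑ jk : V × Fin 4, moveRate lam mu nu p jk.2 *
    ((1 - θ ^ d (s.move jk.1 jk.2)) - (1 - θ ^ d s)) ≤ - θ ^ d s
  have hlt' : d (s.move j k) + 1 ≤ d s := hlt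
  have hgain : θ ^ d s ≤ θ * θ ^ d (s.move j k) := by
    rw [← pow_succ']
    exact pow_le_pow_of_le_one hθ0.le hθ1.le hlt'
  have hsum : ∑ jk : V × Fin 4, moveRate lam mu nu p jk.2 * θ ^ d (s.move jk.1 jk.2) ≥
      moveRate lam mu nu p k * θ ^ d (s.move j k) :=
    Finset.single_le_sum (f := fun jk : V × Fin 4 =>
      moveRate lam mu nu p jk.2 * θ ^ d (s.move jk.1 jk.2))
      (fun jk _ => mul_nonneg (hrate jk.2) (by positivity)) (Finset.mem_univ (j, k))
  have heq : ∑ jk : V × Fin 4, moveRate lam mu nu p jk.2 *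
      ((1 - θ ^ d (s.move jk.1 jk.2)) - (1 - θ ^ d s)) = R * θ ^ d s -
      ∑ jk : V × Fin 4, moveRate lam mu nu p jk.2 * θ ^ d (s.move jk.1 jk.2) := by
    rw [hR, Finset.sum_mul, ← Finset.sum_sub_distrib]
    exact Finset.sum_congr rfl fun _ _ => by ring
  have hθR : m = θ * (R + 1) := by rw [hθ]; field_simp
  have h1 : (R + 1) * θ ^ d s ≤ m * θ ^ d (s.move j k) := by
    rw [hθR]; nlinarith
  have h2 : m * θ ^ d (s.move j k) ≤ moveRate lam mu nu p k * θ ^ d (s.move j k) := by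
    gcongr; exact hmk k hk
  rw [heq]
  linarith

/-- If node `i` is active for a larger fraction of time than its load requires, then there is a
nonnegative function of `(X, Q i)` whose generator is at most `-1` off a given value. -/
theorem exists_lyapunov {lam mu nu p : ℝ} (hlam : 0 < lam) (hmu : 0 < mu) (hnu : 0 < nu)
    (hp : 0 < p) (hp1 : p ≤ 1) {i : V}
    (hload : lam < mu * HardCore.occupancy G (nu / (p * mu)) i) (t : NetState G) :
    ∃ W : Finset V → ℕ → ℝ, (∀ X q, 0 ≤ W X q) ∧
      ∀ s : NetState G, ¬ (s.active = t.active ∧ s.queue i = t.queue i) →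
        generator lam mu nu p (fun u => W u.active (u.queue i)) s ≤ -1 := by
  have hβ : 0 < p * mu := by positivity
  obtain ⟨f, hf⟩ := HardCore.exists_gen_eq_indicator_sub_occupancy G (div_pos hnu hβ) hβ i
  rw [div_mul_cancel₀ _ hβ.ne'] at hf
  set ε : ℝ := mu * HardCore.occupancy G (nu / (p * mu)) i - lam with hε
  have hε0 : 0 < ε := by linarith
  obtain ⟨θ, hθ0, hθ1, hθ⟩ := exists_bounded_generator_le hlam hmu hnu hp hp1 i t
  obtain ⟨K, hK⟩ : ∃ K, ∀ X : Finset V, -(mu * f X) ≤ K := by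
    obtain ⟨K, hK⟩ := (Set.finite_range fun X : Finset V => -(mu * f X)).bddAbove
    exact ⟨K, fun X => hK ⟨X, rfl⟩⟩
  obtain ⟨D, hD⟩ : ∃ D, ∀ X : Finset V, stepsTo i t.active (t.queue i) X 0 ≤ D := by
    obtain ⟨D, hD⟩ := (Set.finite_range fun X : Finset V =>
      stepsTo i t.active (t.queue i) X 0).bddAbove
    exact ⟨D, fun X => hD ⟨X, rfl⟩⟩
  -- When Q_i = 0 one has d ≤ D, so the bounded term has drift at most -C θ^D, which exactly offsets
  -- the boundary correction (ν + μ)/ε.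
  set C : ℝ := 1 / ε * (nu + mu) / θ ^ D with hC
  have hC0 : 0 < C := by positivity
  -- The corrector μ f replaces the fluctuating service rate μ 1_{i ∈ X} by its stationary mean, and
  -- λ minus that mean is -ε.
  have hgen : ∀ s : NetState G,
      generator lam mu nu p (fun u => ((u.queue i : ℝ) + if i ∈ u.active then 1 else 0) +
        (mu * f u.active + K)) s ≤ -ε + if s.queue i = 0 then nu + mu else 0 := by
    intro s
    rw [generator_add, generator_const_mul_add, generator_active,
      hf s.active (HardCore.mem_indepSets.2 s.indep)]
    have := generator_queue_le (lam := lam) hmu hnu hp hp1 i s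
    rw [mul_sub]
    linarith
  refine ⟨fun X q => (1 / ε * (((q : ℝ) + if i ∈ X then 1 else 0) + (mu * f X + K)) + 0) +
    (C * (1 - θ ^ stepsTo i t.active (t.queue i) X q) + 0), fun X q => ?_, fun s hs => ?_⟩
  · have h1 : 0 ≤ mu * f X + K := by linarith [hK X]
    have h2 : (0 : ℝ) ≤ if i ∈ X then 1 else 0 := by split_ifs <;> norm_num
    have h3 : 0 ≤ 1 - θ ^ stepsTo i t.active (t.queue i) X q :=
      sub_nonneg.2 (pow_le_one₀ hθ0.le hθ1.le)
    positivity
  · rw [generator_add, generator_const_mul_add, generator_const_mul_add]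
    have h1 := mul_le_mul_of_nonneg_left (hgen s) (one_div_pos.2 hε0).le
    have h2 := mul_le_mul_of_nonneg_left (hθ s hs) hC0.le
    have h3 : 1 / ε * -ε = -1 := by field_simp
    rw [mul_add, h3] at h1
    by_cases hq : s.queue i = 0
    · rw [if_pos hq] at h1
      have h4 : θ ^ D ≤ θ ^ stepsTo i t.active (t.queue i) s.active (s.queue i) := by
        rw [hq]; exact pow_le_pow_of_le_one hθ0.le hθ1.le (hD _)
      have h5 : C * θ ^ D = 1 / ε * (nu + mu) := by rw [hC]; field_simp
      have h6 := mul_le_mul_of_nonneg_left h4 hC0.le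
      linarith
    · rw [if_neg hq, mul_zero, add_zero] at h1
      have h4 : 0 ≤ C * θ ^ stepsTo i t.active (t.queue i) s.active (s.queue i) := by positivity
      linarith

end NetState

end
/-- On the `L × L` toric grid (`L ≥ 4` even) with normalized load `ρ = λ / (μ / 2) < 1`, for all
sufficiently large `σ = ν / (p μ)` the queue-length process at each node `i` is positive recurrent:
both `Q_i` itself and the Markov process `(X, Q_i)` have finite expected return times. -/
theorem proposition1 (L : ℕ) (hL : 4 ≤ L) (hLeven : Even L) (lam mu : ℝ) (hlam : 0 < lam)
    (hmu : 0 < mu) (hrho : 2 * lam / mu < 1) :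
    ∃ σ₀ : ℝ, ∀ nu p : ℝ, 0 < nu → 0 < p → p ≤ 1 → σ₀ < nu / (p * mu) →
      ∀ i : Fin L × Fin L,
        CTMC.PositiveRecurrent (networkRate (toricGrid L) lam mu nu p)
          (fun s => s.queue i) ∧
        CTMC.PositiveRecurrent (networkRate (toricGrid L) lam mu nu p)
          (fun s => (s.active, s.queue i)) := by
  have hgap : 0 < 1 - 2 * lam / mu := by linarith
  -- Above this threshold 2^(L²)/σ < 1 - ρ, so the occupancy exceeds ρ/2 = λ/μ.
  refine ⟨2 ^ (L * L) / (1 - 2 * lam / mu), fun nu p hnu hp hp1 hσ i => ?_⟩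
  set σ : ℝ := nu / (p * mu) with hσdef
  have hρ0 : 0 < 2 * lam / mu := by positivity
  have hσ1 : (2 : ℝ) ^ (L * L) < σ :=
    lt_of_le_of_lt (le_div_self (by positivity) hgap (by linarith)) hσ
  have hone : (1 : ℝ) ≤ 2 ^ (L * L) := one_le_pow₀ (by norm_num)
  have hσ0 : 0 < σ := by linarith
  have hocc := le_occupancy_toricGrid hLeven (by linarith) hσ1.le i
  have hload : lam < mu * HardCore.occupancy (toricGrid L) σ i := by
    have h1 : 2 ^ (L * L) / σ < 1 - 2 * lam / mu := by
      rw [div_lt_iff₀ hgap] at hσ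
      rw [div_lt_iff₀ hσ0]
      linarith
    have h2 : lam / mu < HardCore.occupancy (toricGrid L) σ i := by
      have : 2 * lam / mu = 2 * (lam / mu) := by ring
      linarith
    rwa [div_lt_iff₀' hmu] at h2
  have hW := NetState.exists_lyapunov hlam hmu hnu hp hp1 hload
  constructor
  · exact NetState.positiveRecurrent_of_generator_le hlam hmu hnu hp hp1 (i := i)
      (fun s t h => h) (fun s t _ h => h) hW
  · exact NetState.positiveRecurrent_of_generator_le hlam hmu hnu hp hp1 (i := i)
      (fun s t h => (Prod.ext_iff.1 h).2) (fun s t h h' => Prod.ext h h') hW
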